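/- **Theorem (obstruction-free universal construction from a racing on consensus objects).** Let $P$ be a set of asynchronous sequential processes (of any cardinality, unknown to the algorithm), and let a sequential object be given by a set of states $S$, an initial state $s_0\in S$ and a transition function $\tau:S\times \mathit{Op}\to S\times \mathit{Res}$. *Base objects.* For each lap $l$ of some set of laps, let $C_l$ be an obstruction-free linearizable consensus object with decision register $d$: sequentially, $d$ is initially $\bot$; $\mathrm{propose}(u)$ writes $u$ to $d$ if $d=\bot$, and returns the value of $d$; and $d$ can be read. Let $R$ be a wait-free racing on the laps, that is, an object with one operation $\mathrm{enter}()$ that returns a lap. A process that has entered a lap leaves it when it next invokes $\mathrm{enter}$. A process enters only laps that are new to it, and in every history there is a strict total order $\ll$ on laps such that, whenever a process $p$ enters a lap $l$, either some process has left $l$ before, or the lap that $p$ has just left is the greatest lap entered in the history that is smaller than $l$ (no condition if no entered lap is smaller). *Algorithm.* Each process $p$ has local variables $s$ (initially $s_0$) and $C$, the consensus object of the lap it entered last ($p$ enters a first lap when it invokes its first operation). To execute $\mathit{op}$, process $p$ repeats the following: (1) while $C.d\neq\bot$, with $C.d=(s'',q)$, set $s:=s''$ and $C:=R.\mathrm{enter}()$;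 (2) compute $(s',v)=\tau(s,\mathit{op})$; (3) if $s'=s$, return $v$; (4) call $C.\mathrm{propose}((s',p))$, and if the decision is $(s'',p)$ for some $s''$, return $v$. *Claim.* This algorithm is an obstruction-free and linearizable implementation of the object $(S,s_0,\tau)$: 1. (Obstruction-freedom) from every reachable configuration, a process with a pending operation that runs alone responds after finitely many of its own steps; 2. (Linearizability) every finite history can be completed, by adding responses to some pending operations and dropping the others, so that its operations can be ordered, consistently with their real-time order, into a legal sequential history of $(S,s_0,\tau)$. Moreover, it uses an unbounded number of consensus objects: if $P\neq\emptyset$ and the object admits an infinite sequence of operations which, applied successively from $s_0$, each change the state, then for every finite set $F$ of laps there is an execution in which some process enters a lap outside $F$. -/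

import Mathlib

/-! ## Shared objects, executions, liveness -/

/-- Events of an execution: `inv p op` is the invocation of `op` by process `p`; `step p o` is one
step of `p` on behalf of its pending operation, which ends that operation with response `r` when
`o = some r`, and is internal when `o = none`. -/
inductive Label (P Op Res : Type*) where
  | inv (p : P) (op : Op)
  | step (p : P) (o : Option Res)

/-- An asynchronous shared-memory implementation of an object with operations `Op` and responses
`Res`, for processes `P`. `invoke` starts an operation, `step p` is the (possibly nondeterministic)
next step of `p`; a process that is scheduled can always take a step. -/
structure Impl (P Op Res : Type*) where
  State : Type*
  init : State
  invoke : P → Op → State → State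
  step : P → State → Set (State × Option Res)
  step_nonempty : ∀ p σ, (step p σ).Nonempty

/-- After the events `h`, process `p` has a pending operation. -/
def Busy {P Op Res : Type*} (h : List (Label P Op Res)) (p : P) : Prop :=
  ∃ (i : ℕ) (op : Op), h[i]? = some (Label.inv p op) ∧
    ∀ k, i < k → ∀ r, h[k]? ≠ some (Label.step p (some r))

namespace Impl

variable {P Op Res : Type*}

/-- After the events `h` leading to `σ`, the event `a` may occur and lead to `σ'`. Processes are
sequential: they invoke only when idle, and take steps only when an operation is pending. -/
def Next (A : Impl P Op Res) (h : List (Label P Op Res)) (σ : A.State) :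
    Label P Op Res → A.State → Prop
  | Label.inv p op, σ' => ¬ Busy h p ∧ σ' = A.invoke p op σ
  | Label.step p o, σ' => Busy h p ∧ (σ', o) ∈ A.step p σ

/-- `A.Run h σ`: some finite execution of `A` has the events `h` and ends in state `σ`. -/
inductive Run (A : Impl P Op Res) : List (Label P Op Res) → A.State → Prop
  | nil : Run A [] A.init
  | snoc {h : List (Label P Op Res)} {σ : A.State} {a : Label P Op Res} {σ' : A.State} :
      Run A h σ → A.Next h σ a σ' → Run A (h ++ [a]) σ'

/-- Obstruction-freedom: a process with a pending operation, running alone from any reachable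
state, cannot take infinitely many steps without responding. -/
def ObstructionFree (A : Impl P Op Res) : Prop :=
  ∀ (h : List (Label P Op Res)) (σ : A.State) (p : P), A.Run h σ → Busy h p →
    ¬ ∃ ρ : ℕ → A.State, ρ 0 = σ ∧ ∀ n, (ρ (n + 1), none) ∈ A.step p (ρ n)

/-- The sequence of states `σ` and events `a` is an infinite execution. -/
def InfRun (A : Impl P Op Res) (σ : ℕ → A.State) (a : ℕ → Label P Op Res) : Prop :=
  σ 0 = A.init ∧ ∀ n, A.Next ((List.range n).map a) (σ n) (a n) (σ (n + 1))

/-- Wait-freedom: in every infinite execution, a process that takes infinitely many steps completes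
each of its operations, whatever the other processes do. -/
def WaitFree (A : Impl P Op Res) : Prop :=
  ∀ (σ : ℕ → A.State) (a : ℕ → Label P Op Res), A.InfRun σ a →
    ∀ p, (∀ N, ∃ n, N ≤ n ∧ ∃ o, a n = Label.step p o) →
      ∀ N, Busy ((List.range N).map a) p → ∃ n, N ≤ n ∧ ∃ r, a n = Label.step p (some r)

end Impl

/-! ## Linearizability -/

/-- A sequential specification: the set of legal sequential histories, each one being a list of
complete operations (process, operation, response) in chronological order. -/
abbrev Spec (P Op Res : Type*) := List (P × Op × Res) → Prop

/-- The event at position `i` of `h` is the invocation of `op` by `p`, and the matching response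
is the event at position `j`, with value `r`. -/
def Completes {P Op Res : Type*} (h : List (Label P Op Res)) (i j : ℕ) (p : P) (op : Op)
    (r : Res) : Prop :=
  i < j ∧ h[i]? = some (Label.inv p op) ∧ h[j]? = some (Label.step p (some r)) ∧
    ∀ k, i < k → k < j → ∀ r', h[k]? ≠ some (Label.step p (some r'))

/-- `L` is a linearization of `h`. An entry `(i, p, op, r)` of `L` is the operation invoked at
position `i` of `h`, with response `r`. All complete operations occur, with their responses; some
pending ones may occur, with a response of our choice; the real-time order is preserved, and the
resulting sequential history is legal. -/
def IsLinearization {P Op Res : Type*} (spec : Spec P Op Res) (h : List (Label P Op Res))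
    (L : List (ℕ × P × Op × Res)) : Prop :=
  (L.map Prod.fst).Nodup ∧
  (∀ x ∈ L, h[x.1]? = some (Label.inv x.2.1 x.2.2.1)) ∧
  (∀ i j p op r, Completes h i j p op r → (i, p, op, r) ∈ L) ∧
  L.Pairwise (fun x y => ¬ ∃ j p op r, Completes h y.1 j p op r ∧ j < x.1) ∧
  spec (L.map Prod.snd)

/-- Every history of `A` has a linearization that is legal for `spec`. -/
def Impl.Linearizable {P Op Res : Type*} (A : Impl P Op Res) (spec : Spec P Op Res) : Prop :=
  ∀ (h : List (Label P Op Res)) (σ : A.State), A.Run h σ → ∃ L, IsLinearization spec h L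

/-- The operations of `w`, executed one after the other from state `s`, return the responses that
are recorded in `w`. -/
def Replays {P S Op Res : Type*} (τ : S → Op → S × Res) : S → List (P × Op × Res) → Prop
  | _, [] => True
  | s, (_, op, r) :: w => (τ s op).2 = r ∧ Replays τ (τ s op).1 w

/-- The specification of the sequential object with initial state `s₀` and transition function `τ`,
where `τ s op` is the new state and the response. -/
def seqSpec (P : Type*) {S Op Res : Type*} (τ : S → Op → S × Res) (s₀ : S) : Spec P Op Res :=
  fun w => Replays τ s₀ w

/-! ## Consensus with a decision register -/

/-- Operations on a consensus object: `propose u`, and `read` of its decision register. -/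
inductive ConsOp (V : Type*) where
  | propose (u : V)
  | read

/-- The state is the decision register, `none` standing for `⊥`. The first proposal is decided;
`propose` returns the decision, and `read` the content of the register. -/
def consStep {V : Type*} : Option V → ConsOp V → Option V × Option V
  | none, ConsOp.propose u => (some u, some u)
  | some v, ConsOp.propose _ => (some v, some v)
  | d, ConsOp.read => (d, d)

def consSpec (P V : Type*) : Spec P (ConsOp V) (Option V) := seqSpec P consStep none

/-! ## Racing -/

/-- In the history `h` of `enter` operations, some process enters lap `l`. -/
def Entered {P Lap : Type*} (h : List (Label P Unit Lap)) (l : Lap) : Prop :=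
  ∃ i j p, Completes h i j p () l

/-- Before position `t` of `h`, some process left lap `l`: a process that has entered `l` leaves it
when it invokes `enter` again. -/
def LeftBefore {P Lap : Type*} (h : List (Label P Unit Lap)) (l : Lap) (t : ℕ) : Prop :=
  ∃ i j q k, Completes h i j q () l ∧ j < k ∧ k < t ∧ h[k]? = some (Label.inv q ())

/-- With the call to `enter` at position `t` of `h`, process `p` leaves lap `l`: this is the lap that
it entered with its preceding call. -/
def JustLeft {P Lap : Type*} (h : List (Label P Unit Lap)) (p : P) (t : ℕ) (l : Lap) : Prop :=
  ∃ i j, Completes h i j p () l ∧ j < t ∧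
    ∀ k, j < k → k < t → ∀ l', h[k]? ≠ some (Label.step p (some l'))

/-- `l'` is the greatest lap smaller than `l` for `lt` among the laps entered in `h`. -/
def IsPredLap {P Lap : Type*} (lt : Lap → Lap → Prop) (h : List (Label P Unit Lap))
    (l' l : Lap) : Prop :=
  Entered h l' ∧ lt l' l ∧ ∀ l'', Entered h l'' → ¬ (lt l' l'' ∧ lt l'' l)

/-- `A` implements a racing, an object whose single operation `enter` returns the lap that is
entered. A process enters only laps that are new to it, and in every history there is a strict total
order on laps such that, whenever `p` enters `l`, either some process has left `l` before, or the
lap that `p` has just left is the greatest one smaller than `l` (if there is a smaller one). -/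
def IsRacing {P Lap : Type*} (A : Impl P Unit Lap) : Prop :=
  ∀ (h : List (Label P Unit Lap)) (σ : A.State), A.Run h σ →
    ∃ lt : Lap → Lap → Prop, IsStrictTotalOrder Lap lt ∧
      ∀ i j p l, Completes h i j p () l →
        (∀ i' j', Completes h i' j' p () l → i' = i) ∧
        (LeftBefore h l j ∨ ∀ l', IsPredLap lt h l' l → JustLeft h p i l')

/-! ## The universal construction

Code of process `p`, with a shared racing `R` on consensus objects `C`, a local variable `cur`
(the current consensus object; the first one is entered at the first invocation) and a local
variable `st` (a copy of the state of the object, initially `s₀`):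

    invoke(op):
      loop
        while cur.d ≠ ⊥ do
          (st, _) := cur.d
          cur := R.enter()
        (s', v) := τ(st, op)
        if s' = st then return v
        (s'', q) := cur.propose((s', p))
        if q = p then return v
-/

/-- Program counter. `test` and `enter` are about to read the decision register and to enter a new
consensus object; in `reading`, `entering` and `proposing` an operation on a base object is pending;
`compute` follows a read that returned `⊥`. The argument `v` is the response to return if the
proposal is decided. -/
inductive Pc (Op Res : Type*) where
  | idle
  | enter (op : Op)
  | entering (op : Op)
  | test (op : Op)
  | reading (op : Op)
  | compute (op : Op)
  | proposing (op : Op) (v : Res)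

/-- The local variables of a process. -/
structure Loc (Lap S Op Res : Type*) where
  cur : Option Lap
  st : S
  pc : Pc Op Res

section Runiv

variable {P Lap S Op Res : Type*}

/-- A global state: the base objects and the local variables. -/
structure UState (R : Impl P Unit Lap)
    (C : Lap → Impl P (ConsOp (S × P)) (Option (S × P))) (Op Res : Type*) where
  rac : R.State
  cons : ∀ l, (C l).State
  loc : P → Loc Lap S Op Res

variable {R : Impl P Unit Lap} {C : Lap → Impl P (ConsOp (S × P)) (Option (S × P))}

open Classical in
/-- Assign the local variables of `p`. -/
noncomputable def UState.setLoc (σ : UState R C Op Res) (p : P) (x : Loc Lap S Op Res) :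
    UState R C Op Res :=
  { σ with loc := Function.update σ.loc p x }

open Classical in
/-- Change the state of the consensus object `l`. -/
noncomputable def UState.setCons (σ : UState R C Op Res) (l : Lap) (c : (C l).State) :
    UState R C Op Res :=
  { σ with cons := Function.update σ.cons l c }

/-- Change the state of the racing. -/
def UState.setRac (σ : UState R C Op Res) (x : R.State) : UState R C Op Res :=
  { σ with rac := x }

/-- The effect of a step on the racing, in the course of `enter`. -/
noncomputable def afterEnter (σ : UState R C Op Res) (p : P) (op : Op)
    (y : R.State × Option Lap) : UState R C Op Res × Option Res :=
  match y.2 with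
  | none => (σ.setRac y.1, none)
  | some l => ((σ.setRac y.1).setLoc p ⟨some l, (σ.loc p).st, Pc.test op⟩, none)

/-- The effect of a step on consensus object `l`, in the course of a read of its decision. -/
noncomputable def afterRead (σ : UState R C Op Res) (p : P) (op : Op) (l : Lap)
    (y : (C l).State × Option (Option (S × P))) : UState R C Op Res × Option Res :=
  match y.2 with
  | none => (σ.setCons l y.1, none)
  | some none => ((σ.setCons l y.1).setLoc p ⟨some l, (σ.loc p).st, Pc.compute op⟩, none)
  | some (some d) => ((σ.setCons l y.1).setLoc p ⟨some l, d.1, Pc.enter op⟩, none)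

open Classical in
/-- The effect of a step on consensus object `l`, in the course of a proposal. -/
noncomputable def afterPropose (σ : UState R C Op Res) (p : P) (op : Op) (v : Res) (l : Lap)
    (y : (C l).State × Option (Option (S × P))) : UState R C Op Res × Option Res :=
  match y.2 with
  | none => (σ.setCons l y.1, none)
  | some d =>
    if d.map Prod.snd = some p then
      ((σ.setCons l y.1).setLoc p ⟨some l, (σ.loc p).st, Pc.idle⟩, some v)
    else
      ((σ.setCons l y.1).setLoc p ⟨some l, (σ.loc p).st, Pc.test op⟩, none)

open Classical in
/-- The local computation that follows a read of `⊥`: return if the operation does not change the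
state, otherwise start a proposal. -/
noncomputable def doCompute (τ : S → Op → S × Res) (σ : UState R C Op Res) (p : P) (op : Op)
    (l : Lap) : UState R C Op Res × Option Res :=
  let s := (σ.loc p).st
  if (τ s op).1 = s then
    (σ.setLoc p ⟨some l, s, Pc.idle⟩, some (τ s op).2)
  else
    ((σ.setCons l ((C l).invoke p (ConsOp.propose ((τ s op).1, p)) (σ.cons l))).setLoc p
      ⟨some l, s, Pc.proposing op (τ s op).2⟩, none)

/-- One step of process `p`. The last case is never reached by a process with a pending operation. -/
noncomputable def runivStep (τ : S → Op → S × Res) (p : P) (σ : UState R C Op Res) :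
    Set (UState R C Op Res × Option Res) :=
  match (σ.loc p).pc, (σ.loc p).cur with
  | Pc.enter op, c =>
      {((σ.setRac (R.invoke p () σ.rac)).setLoc p ⟨c, (σ.loc p).st, Pc.entering op⟩, none)}
  | Pc.entering op, _ => afterEnter σ p op '' R.step p σ.rac
  | Pc.test op, some l =>
      {((σ.setCons l ((C l).invoke p ConsOp.read (σ.cons l))).setLoc p
        ⟨some l, (σ.loc p).st, Pc.reading op⟩, none)}
  | Pc.reading op, some l => afterRead σ p op l '' (C l).step p (σ.cons l)
  | Pc.compute op, some l => {doCompute τ σ p op l}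
  | Pc.proposing op v, some l => afterPropose σ p op v l '' (C l).step p (σ.cons l)
  | _, _ => {(σ, none)}

/-- The universal construction for the object with initial state `s₀` and transition function `τ`,
from the racing `R` on the consensus objects `C`. -/
noncomputable def runiv (τ : S → Op → S × Res) (s₀ : S) (R : Impl P Unit Lap)
    (C : Lap → Impl P (ConsOp (S × P)) (Option (S × P))) : Impl P Op Res where
  State := UState R C Op Res
  init := ⟨R.init, fun l => (C l).init, fun _ => ⟨none, s₀, Pc.idle⟩⟩
  invoke p op σ :=
    let x := σ.loc p
    σ.setLoc p ⟨x.cur, x.st, if x.cur.isSome then Pc.test op else Pc.enter op⟩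
  step := runivStep τ
  step_nonempty p σ := by
    unfold runivStep
    split
    all_goals first
      | exact Set.singleton_nonempty _
      | exact (Impl.step_nonempty _ _ _).image _

end Runiv

/-! ## Histories -/

section Histories

variable {P Op Res : Type*}

/-! All arguments take place in the global time of the construction. An execution is a list of
events, each paired with at most one event on a base object; filtering this list gives the histories
of the racing and of each consensus object, and facts about these are pulled back to global times.

Linearizability. A process leaves a lap only after reading its decision. By induction on the time of
entry, when a lap is entered, every smaller lap of the history is already decided
(`decidedBefore_of_lt`). Hence a process that reads `⊥` at lap `l` entered `l` before anyone left
it; the racing property then says that it came from the predecessor of `l`, so it computes from the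
decision of that predecessor, or from `s₀` at the least lap (`compute_state`). All computations at
one lap thus start from the same state. A process proposes at most once at a lap (`propose_unique`),
so the process identifier in a decision determines the winning operation. The linearization runs
through the laps in increasing order and lists, for each lap, the operations that leave the state
unchanged, in the order of their computations, followed by the winner. It is legal because the
winner produces the state from which the next lap computes. It respects real time because each
operation, after its invocation, started a read of its lap that returned `⊥`, so the lap was not yet
known to be decided.

Obstruction-freedom. A process that runs alone without responding would enter laps or propose
infinitely often. Each lap is entered once and receives one proposal from it, and only finitely many
laps have proposals from before, so it reaches a lap without proposals. There its own proposal is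
the only one, wins, and produces a response (`not_propose`, `false_of_racing`).

Unboundedness. A single process executes the given operations one after the other. Each must win a
lap that was not decided before, so the set of decided laps grows beyond any finite set
(`SoloPhase.step`, `runiv_unbounded`). -/

theorem busy_append_singleton (h : List (Label P Op Res)) (a : Label P Op Res) (p : P) :
    Busy (h ++ [a]) p ↔ (∃ op, a = Label.inv p op) ∨ (Busy h p ∧ ∀ r, a ≠ Label.step p (some r)) := by
  constructor
  · rintro ⟨i, op, hi, hk⟩
    have hlt : i < h.length + 1 := by
      have := (List.getElem?_eq_some_iff.1 hi).1
      simpa using this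
    rcases Nat.lt_succ_iff_lt_or_eq.1 hlt with hl | hl
    · right
      rw [List.getElem?_append_left hl] at hi
      refine ⟨⟨i, op, hi, fun k hik r hr => ?_⟩, fun r hr => ?_⟩
      · have hkl := (List.getElem?_eq_some_iff.1 hr).1
        exact hk k hik r (by rw [List.getElem?_append_left hkl]; exact hr)
      · exact hk h.length hl r (by simp [hr])
    · left
      subst hl
      exact ⟨op, by simpa using hi⟩
  · rintro (⟨op, rfl⟩ | ⟨⟨i, op, hi, hk⟩, ha⟩)
    · refine ⟨h.length, op, by simp, fun k hk r hr => ?_⟩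
      have := (List.getElem?_eq_some_iff.1 hr).1
      simp at this
      omega
    · have hl := (List.getElem?_eq_some_iff.1 hi).1
      refine ⟨i, op, by rw [List.getElem?_append_left hl]; exact hi, fun k hik r hr => ?_⟩
      have hkl := (List.getElem?_eq_some_iff.1 hr).1
      rcases Nat.lt_or_ge k h.length with hkh | hkh
      · rw [List.getElem?_append_left hkh] at hr
        exact hk k hik r hr
      · have : k = h.length := by simp at hkl; omega
        subst this
        exact ha r (by simpa using hr)

theorem not_busy_nil (p : P) : ¬ Busy ([] : List (Label P Op Res)) p := by
  rintro ⟨i, op, hi, -⟩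
  simp at hi

/-- `Completes`, for a history in which some positions carry no event. -/
def CompletesAt (e : ℕ → Option (Label P Op Res)) (i j : ℕ) (p : P) (op : Op) (r : Res) : Prop :=
  i < j ∧ e i = some (Label.inv p op) ∧ e j = some (Label.step p (some r)) ∧
    ∀ k, i < k → k < j → ∀ r', e k ≠ some (Label.step p (some r'))

end Histories

/-! ## Positions in a filtered list -/

section Positions

variable {α β : Type*}

/-- The number of entries before position `t` that `f` keeps. -/
def filteredPos (f : α → Option β) (G : List α) (t : ℕ) : ℕ := ((G.take t).filterMap f).length

/-- The entry at position `t`, seen through `f`. -/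
def view (f : α → Option β) (G : List α) (t : ℕ) : Option β := G[t]?.bind f

theorem filteredPos_mono (f : α → Option β) (G : List α) {s t : ℕ} (h : s ≤ t) :
    filteredPos f G s ≤ filteredPos f G t :=
  ((List.take_prefix_take_left h).sublist.filterMap f).length_le

theorem view_eq_some {f : α → Option β} {G : List α} {t : ℕ} {b : β} :
    view f G t = some b ↔ ∃ g, G[t]? = some g ∧ f g = some b := by
  simp [view, Option.bind_eq_some_iff]

theorem filteredPos_succ {f : α → Option β} {G : List α} {t : ℕ} {b : β}
    (h : view f G t = some b) : filteredPos f G (t + 1) = filteredPos f G t + 1 := by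
  obtain ⟨g, hg, hb⟩ := view_eq_some.1 h
  simp [filteredPos, List.take_add_one, hg, hb]

theorem filteredPos_lt {f : α → Option β} {G : List α} {s t : ℕ} {b : β}
    (h : view f G s = some b) (hst : s < t) : filteredPos f G s < filteredPos f G t := by
  have := filteredPos_succ h
  have := filteredPos_mono f G (s := s + 1) (t := t) hst
  omega

theorem lt_of_filteredPos_lt {f : α → Option β} {G : List α} {s t : ℕ}
    (h : filteredPos f G s < filteredPos f G t) : s < t := by
  by_contra hst
  have := filteredPos_mono f G (not_lt.1 hst)
  omega

theorem getElem?_filteredPos {f : α → Option β} {G : List α} {t : ℕ} {b : β}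
    (h : view f G t = some b) : (G.filterMap f)[filteredPos f G t]? = some b := by
  obtain ⟨g, hg, hb⟩ := view_eq_some.1 h
  obtain ⟨ht, hg⟩ := List.getElem?_eq_some_iff.1 hg
  have hG : G = G.take t ++ g :: G.drop (t + 1) := by
    rw [← hg, List.getElem_cons_drop, List.take_append_drop]
  have : G.filterMap f = (G.take t).filterMap f ++ b :: (G.drop (t + 1)).filterMap f := by
    conv_lhs => rw [hG]
    simp [hb]
  rw [this, filteredPos]
  simp

theorem exists_view_of_getElem?_filterMap {f : α → Option β} {G : List α} {a : ℕ} {b : β}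
    (h : (G.filterMap f)[a]? = some b) : ∃ t, view f G t = some b ∧ filteredPos f G t = a := by
  induction G generalizing a with
  | nil => simp at h
  | cons g G ih =>
    rcases hg : f g with _ | c
    · rw [List.filterMap_cons_none hg] at h
      obtain ⟨t, ht, rfl⟩ := ih h
      exact ⟨t + 1, by simpa [view] using ht, by simp [filteredPos, hg]⟩
    · rw [List.filterMap_cons_some hg] at h
      rcases a with _ | a
      · exact ⟨0, by simp_all [view], by simp [filteredPos]⟩
      · obtain ⟨t, ht, rfl⟩ := ih (by simpa using h)
        exact ⟨t + 1, by simpa [view] using ht, by simp [filteredPos, hg]⟩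

theorem view_lt_length {f : α → Option β} {G : List α} {t : ℕ} {b : β}
    (h : view f G t = some b) : t < G.length := by
  obtain ⟨g, hg, -⟩ := view_eq_some.1 h
  exact (List.getElem?_eq_some_iff.1 hg).1

variable {P Op Res : Type*}

/-- `filteredPos` is strictly increasing on the times that `f` keeps, and every position of the
filtered list comes from such a time. Intervals without a response therefore correspond to each
other, here and in the converse below. -/
theorem CompletesAt.completes {f : α → Option (Label P Op Res)} {G : List α} {i j : ℕ} {p : P}
    {op : Op} {r : Res} (h : CompletesAt (view f G) i j p op r) :
    Completes (G.filterMap f) (filteredPos f G i) (filteredPos f G j) p op r := by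
  obtain ⟨hij, hi, hj, hk⟩ := h
  refine ⟨filteredPos_lt hi hij, getElem?_filteredPos hi, getElem?_filteredPos hj, ?_⟩
  intro k hik hkj r' hr
  obtain ⟨t, ht, rfl⟩ := exists_view_of_getElem?_filterMap hr
  exact hk t (lt_of_filteredPos_lt hik) (lt_of_filteredPos_lt hkj) r' ht

theorem Completes.exists_completesAt {f : α → Option (Label P Op Res)} {G : List α} {a b : ℕ}
    {p : P} {op : Op} {r : Res} (h : Completes (G.filterMap f) a b p op r) :
    ∃ i j, filteredPos f G i = a ∧ filteredPos f G j = b ∧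
      CompletesAt (view f G) i j p op r := by
  obtain ⟨hab, ha, hb, hk⟩ := h
  obtain ⟨i, hi, rfl⟩ := exists_view_of_getElem?_filterMap ha
  obtain ⟨j, hj, rfl⟩ := exists_view_of_getElem?_filterMap hb
  refine ⟨i, j, rfl, rfl, lt_of_filteredPos_lt hab, hi, hj, fun k hik hkj r' hr => ?_⟩
  exact hk _ (filteredPos_lt hi hik) (filteredPos_lt hr hkj) r' (getElem?_filteredPos hr)

end Positions

/-! ## Linearizable consensus -/

section Consensus

variable {P V : Type*}

theorem Replays.eq_of_decided {u : V} {w : List (P × ConsOp V × Option V)}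
    (h : Replays consStep (some u) w) : ∀ x ∈ w, x.2.2 = some u := by
  induction w with
  | nil => simp
  | cons x w ih =>
    obtain ⟨p, op, r⟩ := x
    rcases op with v | _ <;> obtain ⟨h1, h2⟩ := h <;> simp only [consStep] at h1 h2 <;>
      simpa [h1] using fun a b c hx => ih h2 _ hx

/-- The register changes only once: before the first proposal there are only reads of `⊥`, and from
it on every response is the value it wrote. -/
theorem Replays.consensus_split {w : List (P × ConsOp V × Option V)}
    (h : Replays consStep none w) :
    ∃ w₁ w₂, w = w₁ ++ w₂ ∧ (∀ x ∈ w₁, x.2 = (ConsOp.read, none)) ∧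
      (w₂ = [] ∨ ∃ u p, (p, ConsOp.propose u, some u) ∈ w₂ ∧ ∀ x ∈ w₂, x.2.2 = some u) := by
  induction w with
  | nil => exact ⟨[], [], rfl, by simp, Or.inl rfl⟩
  | cons x w ih =>
    obtain ⟨p, op, r⟩ := x
    rcases op with v | _
    · obtain ⟨h1, h2⟩ := h
      simp only [consStep] at h1 h2
      subst h1
      refine ⟨[], _, rfl, by simp, Or.inr ⟨v, p, by simp, ?_⟩⟩
      simpa using fun a b c hx => h2.eq_of_decided _ hx
    · obtain ⟨h1, h2⟩ := h
      simp only [consStep] at h1 h2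
      subst h1
      obtain ⟨w₁, w₂, rfl, hw₁, hw₂⟩ := ih h2
      exact ⟨(p, ConsOp.read, none) :: w₁, w₂, rfl, by simpa using hw₁, hw₂⟩

variable {h : List (Label P (ConsOp V) (Option V))}

theorem linearization_split {L : List (ℕ × P × ConsOp V × Option V)}
    (hL : IsLinearization (consSpec P V) h L) :
    ∃ L₁ L₂, L = L₁ ++ L₂ ∧ (∀ x ∈ L₁, x.2.2 = (ConsOp.read, none)) ∧
      (L₂ = [] ∨ ∃ u, (∃ i p, (i, p, ConsOp.propose u, some u) ∈ L₂) ∧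
        ∀ x ∈ L₂, x.2.2.2 = some u) := by
  obtain ⟨w₁, w₂, hw, h₁, h₂⟩ := Replays.consensus_split hL.2.2.2.2
  obtain ⟨L₁, L₂, rfl, rfl, rfl⟩ := List.map_eq_append_iff.1 hw
  refine ⟨L₁, L₂, rfl, fun x hx => h₁ _ (List.mem_map_of_mem hx), ?_⟩
  rcases h₂ with h₂ | ⟨u, p, hm, hu⟩
  · exact Or.inl (by simpa using h₂)
  · obtain ⟨⟨i, y⟩, hy, rfl⟩ := List.mem_map.1 hm
    exact Or.inr ⟨u, ⟨i, p, hy⟩, fun x hx => hu _ (List.mem_map_of_mem hx)⟩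

/-- All responses other than `⊥` lie in the second block of the linearization, where they are equal.
-/
theorem consensus_agreement (hlin : ∃ L, IsLinearization (consSpec P V) h L) {i j i' j' : ℕ}
    {p p' : P} {op op' : ConsOp V} {u u' : V} (hc : Completes h i j p op (some u))
    (hc' : Completes h i' j' p' op' (some u')) : u = u' := by
  obtain ⟨L, hL⟩ := hlin
  obtain ⟨L₁, L₂, rfl, h₁, h₂⟩ := linearization_split hL
  have key : ∀ {i j p op u}, Completes h i j p op (some u) → (i, p, op, some u) ∈ L₂ := by
    intro i j p op u hc
    refine (List.mem_append.1 (hL.2.2.1 _ _ _ _ _ hc)).resolve_left fun hm => ?_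
    simpa using h₁ _ hm
  rcases h₂ with rfl | ⟨w, -, hw⟩
  · simpa using key hc
  · have e1 := hw _ (key hc)
    have e2 := hw _ (key hc')
    simp_all

theorem consensus_validity (hlin : ∃ L, IsLinearization (consSpec P V) h L) {i j : ℕ}
    {p : P} {op : ConsOp V} {u : V} (hc : Completes h i j p op (some u)) :
    ∃ (k : ℕ) (q : P), h[k]? = some (Label.inv q (ConsOp.propose u)) := by
  obtain ⟨L, hL⟩ := hlin
  obtain ⟨L₁, L₂, rfl, h₁, h₂⟩ := linearization_split hL
  have hm : (i, p, op, some u) ∈ L₂ := by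
    refine (List.mem_append.1 (hL.2.2.1 _ _ _ _ _ hc)).resolve_left fun hm => ?_
    simpa using h₁ _ hm
  rcases h₂ with rfl | ⟨w, ⟨k, q, hk⟩, hw⟩
  · simp at hm
  · obtain rfl : u = w := by simpa using hw _ hm
    exact ⟨k, q, hL.2.1 _ (List.mem_append_right _ hk)⟩

theorem consensus_propose_ne_none (hlin : ∃ L, IsLinearization (consSpec P V) h L) {i j : ℕ}
    {p : P} {u : V} : ¬ Completes h i j p (ConsOp.propose u) none := by
  intro hc
  obtain ⟨L, hL⟩ := hlin
  obtain ⟨L₁, L₂, rfl, h₁, h₂⟩ := linearization_split hL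
  rcases List.mem_append.1 (hL.2.2.1 _ _ _ _ _ hc) with hm | hm
  · simpa using h₁ _ hm
  · rcases h₂ with rfl | ⟨w, -, hw⟩
    · simp at hm
    · simpa using hw _ hm

/-- The response `⊥` lies in the first block and `u` in the second, so the operation returning `⊥`
is linearized first. The real-time condition then forbids that it starts after the other has
returned. -/
theorem consensus_read_after (hlin : ∃ L, IsLinearization (consSpec P V) h L) {i j i' j' : ℕ}
    {p p' : P} {op op' : ConsOp V} {u : V} (hc : Completes h i j p op (some u))
    (hc' : Completes h i' j' p' op' none) : ¬ j < i' := by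
  obtain ⟨L, hL⟩ := hlin
  obtain ⟨L₁, L₂, rfl, h₁, h₂⟩ := linearization_split hL
  have hm : (i, p, op, some u) ∈ L₂ := by
    refine (List.mem_append.1 (hL.2.2.1 _ _ _ _ _ hc)).resolve_left fun hm => ?_
    simpa using h₁ _ hm
  have hm' : (i', p', op', none) ∈ L₁ := by
    refine (List.mem_append.1 (hL.2.2.1 _ _ _ _ _ hc')).resolve_right fun hm' => ?_
    rcases h₂ with rfl | ⟨w, -, hw⟩
    · simp at hm'
    · simpa using hw _ hm'
  intro hj
  exact (List.pairwise_append.1 hL.2.2.2.1).2.2 _ hm' _ hm ⟨j, p, op, some u, hc, hj⟩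

end Consensus

/-! ## Traces of the universal construction -/

/-- The event on a base object that goes with a step of the universal construction, if any. -/
inductive BaseEvent (P Lap S : Type*) where
  | silent
  | rac (b : Label P Unit Lap)
  | cons (l : Lap) (b : Label P (ConsOp (S × P)) (Option (S × P)))

/-- An event of the universal construction, with the event on a base object that goes with it. -/
abbrev Event (P Lap S Op Res : Type*) := Label P Op Res × BaseEvent P Lap S

/-- The operation in progress. -/
def Pc.op? {Op Res : Type*} : Pc Op Res → Option Op
  | Pc.idle => none
  | Pc.enter op => some op
  | Pc.entering op => some op
  | Pc.test op => some op
  | Pc.reading op => some op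
  | Pc.compute op => some op
  | Pc.proposing op _ => some op

section Trace

variable {P Lap S Op Res : Type*}

/-- The event on the racing. -/
def racEvent (g : Event P Lap S Op Res) : Option (Label P Unit Lap) :=
  match g.2 with
  | BaseEvent.rac b => some b
  | _ => none

open Classical in
/-- The event on the consensus object `l`. -/
noncomputable def consEvent (l : Lap) (g : Event P Lap S Op Res) :
    Option (Label P (ConsOp (S × P)) (Option (S × P))) :=
  match g.2 with
  | BaseEvent.cons l' b => if l' = l then some b else none
  | _ => none

@[simp] theorem racEvent_silent (a : Label P Op Res) :
    racEvent ((a, BaseEvent.silent) : Event P Lap S Op Res) = none := rfl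

@[simp] theorem racEvent_rac (a : Label P Op Res) (b : Label P Unit Lap) :
    racEvent ((a, BaseEvent.rac b) : Event P Lap S Op Res) = some b := rfl

@[simp] theorem racEvent_cons (a : Label P Op Res) (l : Lap)
    (b : Label P (ConsOp (S × P)) (Option (S × P))) :
    racEvent ((a, BaseEvent.cons l b) : Event P Lap S Op Res) = none := rfl

@[simp] theorem consEvent_silent (l : Lap) (a : Label P Op Res) :
    consEvent l ((a, BaseEvent.silent) : Event P Lap S Op Res) = none := rfl

@[simp] theorem consEvent_rac (l : Lap) (a : Label P Op Res) (b : Label P Unit Lap) :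
    consEvent l ((a, BaseEvent.rac b) : Event P Lap S Op Res) = none := rfl

@[simp] theorem consEvent_cons_self (l : Lap) (a : Label P Op Res)
    (b : Label P (ConsOp (S × P)) (Option (S × P))) :
    consEvent l ((a, BaseEvent.cons l b) : Event P Lap S Op Res) = some b := by
  simp [consEvent]

theorem consEvent_eq_some {l : Lap} {g : Event P Lap S Op Res}
    {b : Label P (ConsOp (S × P)) (Option (S × P))} :
    consEvent l g = some b ↔ g.2 = BaseEvent.cons l b := by
  obtain ⟨a, _ | b | ⟨l', b⟩⟩ := g
  · simp
  · simp
  · simp only [consEvent]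
    split_ifs with h <;> simp [h]

theorem racEvent_eq_some {g : Event P Lap S Op Res} {b : Label P Unit Lap} :
    racEvent g = some b ↔ g.2 = BaseEvent.rac b := by
  obtain ⟨a, _ | b | ⟨l', b⟩⟩ := g <;> simp [racEvent]

/-- `LocalStep τ p x a e y`: process `p` moves from the local state `x` to `y` with the event `a`, in
the course of which the event `e` occurs on a base object. -/
inductive LocalStep (τ : S → Op → S × Res) (p : P) : Loc Lap S Op Res → Label P Op Res →
    BaseEvent P Lap S → Loc Lap S Op Res → Prop
  | inv (c : Option Lap) (s : S) (op : Op) :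
      LocalStep τ p ⟨c, s, Pc.idle⟩ (Label.inv p op) BaseEvent.silent
        ⟨c, s, if c.isSome then Pc.test op else Pc.enter op⟩
  | enter (c : Option Lap) (s : S) (op : Op) :
      LocalStep τ p ⟨c, s, Pc.enter op⟩ (Label.step p none) (BaseEvent.rac (Label.inv p ()))
        ⟨c, s, Pc.entering op⟩
  | entering (c : Option Lap) (s : S) (op : Op) :
      LocalStep τ p ⟨c, s, Pc.entering op⟩ (Label.step p none)
        (BaseEvent.rac (Label.step p none)) ⟨c, s, Pc.entering op⟩
  | entered (c : Option Lap) (s : S) (op : Op) (l : Lap) :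
      LocalStep τ p ⟨c, s, Pc.entering op⟩ (Label.step p none)
        (BaseEvent.rac (Label.step p (some l))) ⟨some l, s, Pc.test op⟩
  | test (l : Lap) (s : S) (op : Op) :
      LocalStep τ p ⟨some l, s, Pc.test op⟩ (Label.step p none)
        (BaseEvent.cons l (Label.inv p ConsOp.read)) ⟨some l, s, Pc.reading op⟩
  | reading (l : Lap) (s : S) (op : Op) :
      LocalStep τ p ⟨some l, s, Pc.reading op⟩ (Label.step p none)
        (BaseEvent.cons l (Label.step p none)) ⟨some l, s, Pc.reading op⟩
  | readNone (l : Lap) (s : S) (op : Op) :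
      LocalStep τ p ⟨some l, s, Pc.reading op⟩ (Label.step p none)
        (BaseEvent.cons l (Label.step p (some none))) ⟨some l, s, Pc.compute op⟩
  | readSome (l : Lap) (s : S) (op : Op) (d : S × P) :
      LocalStep τ p ⟨some l, s, Pc.reading op⟩ (Label.step p none)
        (BaseEvent.cons l (Label.step p (some (some d)))) ⟨some l, d.1, Pc.enter op⟩
  | ret (l : Lap) (s : S) (op : Op) (h : (τ s op).1 = s) :
      LocalStep τ p ⟨some l, s, Pc.compute op⟩ (Label.step p (some (τ s op).2))
        BaseEvent.silent ⟨some l, s, Pc.idle⟩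
  | propose (l : Lap) (s : S) (op : Op) (h : (τ s op).1 ≠ s) :
      LocalStep τ p ⟨some l, s, Pc.compute op⟩ (Label.step p none)
        (BaseEvent.cons l (Label.inv p (ConsOp.propose ((τ s op).1, p))))
        ⟨some l, s, Pc.proposing op (τ s op).2⟩
  | proposing (l : Lap) (s : S) (op : Op) (v : Res) :
      LocalStep τ p ⟨some l, s, Pc.proposing op v⟩ (Label.step p none)
        (BaseEvent.cons l (Label.step p none)) ⟨some l, s, Pc.proposing op v⟩
  | win (l : Lap) (s : S) (op : Op) (v : Res) (d : Option (S × P))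
      (h : d.map Prod.snd = some p) :
      LocalStep τ p ⟨some l, s, Pc.proposing op v⟩ (Label.step p (some v))
        (BaseEvent.cons l (Label.step p (some d))) ⟨some l, s, Pc.idle⟩
  | lose (l : Lap) (s : S) (op : Op) (v : Res) (d : Option (S × P))
      (h : d.map Prod.snd ≠ some p) :
      LocalStep τ p ⟨some l, s, Pc.proposing op v⟩ (Label.step p none)
        (BaseEvent.cons l (Label.step p (some d))) ⟨some l, s, Pc.test op⟩

/-- The events `G` lead through the local states `X t`, for `t ≤ G.length`. -/
structure Trace (τ : S → Op → S × Res) (s₀ : S) (G : List (Event P Lap S Op Res))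
    (X : ℕ → P → Loc Lap S Op Res) : Prop where
  init : X 0 = fun _ => ⟨none, s₀, Pc.idle⟩
  step : ∀ t g, G[t]? = some g → ∃ p, LocalStep τ p (X t p) g.1 g.2 (X (t + 1) p) ∧
    ∀ q, q ≠ p → X (t + 1) q = X t q

variable {τ : S → Op → S × Res} {s₀ : S} {G : List (Event P Lap S Op Res)}
  {X : ℕ → P → Loc Lap S Op Res}

/-- The process of an event. -/
def Label.proc : Label P Op Res → P
  | Label.inv p _ => p
  | Label.step p _ => p

theorem LocalStep.proc_eq {p : P} {x y : Loc Lap S Op Res} {a : Label P Op Res}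
    {e : BaseEvent P Lap S} (h : LocalStep τ p x a e y) : a.proc = p := by
  cases h <;> rfl

theorem LocalStep.rac_proc {p : P} {x y : Loc Lap S Op Res} {a : Label P Op Res}
    {b : Label P Unit Lap} (h : LocalStep τ p x a (BaseEvent.rac b) y) : b.proc = p := by
  cases h <;> rfl

theorem LocalStep.cons_proc {p : P} {x y : Loc Lap S Op Res} {a : Label P Op Res} {l : Lap}
    {b : Label P (ConsOp (S × P)) (Option (S × P))}
    (h : LocalStep τ p x a (BaseEvent.cons l b) y) : b.proc = p := by
  cases h <;> rfl

namespace Trace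

variable (T : Trace τ s₀ G X)
include T

theorem localStep {t : ℕ} {g : Event P Lap S Op Res} (h : G[t]? = some g) :
    LocalStep τ g.1.proc (X t g.1.proc) g.1 g.2 (X (t + 1) g.1.proc) := by
  obtain ⟨p, hp, -⟩ := T.step t g h
  rwa [hp.proc_eq]

theorem frame {t : ℕ} {g : Event P Lap S Op Res} (h : G[t]? = some g) {q : P}
    (hq : q ≠ g.1.proc) : X (t + 1) q = X t q := by
  obtain ⟨p, hp, hf⟩ := T.step t g h
  exact hf q (by rwa [hp.proc_eq] at hq)

theorem eq_or_localStep {t : ℕ} (ht : t < G.length) (p : P) :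
    X (t + 1) p = X t p ∨ LocalStep τ p (X t p) G[t].1 G[t].2 (X (t + 1) p) := by
  by_cases h : p = G[t].1.proc
  · right
    have := T.localStep (List.getElem?_eq_getElem ht)
    rwa [← h] at this
  · exact Or.inl (T.frame (List.getElem?_eq_getElem ht) h)

/-- If `Q` holds of `p` at time `t`, then it has held since `p` made it true. -/
theorem exists_entry (p : P) (Q : Loc Lap S Op Res → Prop) {k t : ℕ} (hkt : k ≤ t)
    (ht : t ≤ G.length) (h0 : ¬ Q (X k p)) (hQ : Q (X t p)) :
    ∃ m a e, k ≤ m ∧ m < t ∧ ¬ Q (X m p) ∧ (∀ m', m < m' → m' ≤ t → Q (X m' p)) ∧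
      G[m]? = some (a, e) ∧ LocalStep τ p (X m p) a e (X (m + 1) p) := by
  induction t, hkt using Nat.le_induction with
  | base => exact absurd hQ h0
  | succ t hkt ih =>
    by_cases hQt : Q (X t p)
    · obtain ⟨m, a, e, hkm, hm, hn, hall, hg, hs⟩ := ih (by omega) hQt
      refine ⟨m, a, e, hkm, by omega, hn, fun m' h1 h2 => ?_, hg, hs⟩
      rcases Nat.lt_or_ge t m' with h | h
      · obtain rfl : m' = t + 1 := by omega
        exact hQ
      · exact hall m' h1 h
    · rcases T.eq_or_localStep (t := t) (by omega) p with h | h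
      · exact absurd (h ▸ hQ) hQt
      · refine ⟨t, _, _, hkt, by omega, hQt, fun m' h1 h2 => ?_,
          List.getElem?_eq_getElem (by omega), h⟩
        obtain rfl : m' = t + 1 := by omega
        exact hQ

/-- If `Q` holds of `p` at time `k` and fails at time `t`, then `p` makes it false in between. -/
theorem exists_exit (p : P) (Q : Loc Lap S Op Res → Prop) {k t : ℕ} (hkt : k ≤ t)
    (ht : t ≤ G.length) (h0 : Q (X k p)) (hQ : ¬ Q (X t p)) :
    ∃ m a e, k ≤ m ∧ m < t ∧ ¬ Q (X (m + 1) p) ∧ (∀ m', k ≤ m' → m' ≤ m → Q (X m' p)) ∧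
      G[m]? = some (a, e) ∧ LocalStep τ p (X m p) a e (X (m + 1) p) := by
  induction t using Nat.strong_induction_on with
  | _ t ih =>
    by_cases hex : ∃ m', k ≤ m' ∧ m' < t ∧ ¬ Q (X m' p)
    · obtain ⟨m', h1, h2, h3⟩ := hex
      obtain ⟨m, a, e, h⟩ := ih m' h2 h1 (by omega) h3
      exact ⟨m, a, e, h.1, by omega, h.2.2⟩
    · push Not at hex
      obtain ⟨t, rfl⟩ : ∃ t', t = t' + 1 := by
        rcases t with _ | t
        · obtain rfl : k = 0 := by omega
          exact absurd h0 hQ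
        · exact ⟨t, rfl⟩
      have hk : k ≤ t := by
        by_contra hk
        obtain rfl : k = t + 1 := by omega
        exact hQ h0
      rcases T.eq_or_localStep (t := t) (by omega) p with h | h
      · exact absurd (h ▸ hex t hk (by omega)) hQ
      · exact ⟨t, _, _, hk, by omega, hQ, fun m' h1 h2 => hex m' h1 (by omega),
          List.getElem?_eq_getElem (by omega), h⟩

theorem cons_step {t : ℕ} {l : Lap} {b : Label P (ConsOp (S × P)) (Option (S × P))}
    (h : view (consEvent l) G t = some b) : ∃ a, G[t]? = some (a, BaseEvent.cons l b) ∧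
      LocalStep τ b.proc (X t b.proc) a (BaseEvent.cons l b) (X (t + 1) b.proc) := by
  obtain ⟨⟨a, e⟩, hg, hb⟩ := view_eq_some.1 h
  obtain rfl : e = _ := consEvent_eq_some.1 hb
  obtain ⟨p, hp, -⟩ := T.step t _ hg
  obtain rfl := hp.cons_proc
  exact ⟨a, hg, hp⟩

theorem rac_step {t : ℕ} {b : Label P Unit Lap}
    (h : view racEvent G t = some b) : ∃ a, G[t]? = some (a, BaseEvent.rac b) ∧
      LocalStep τ b.proc (X t b.proc) a (BaseEvent.rac b) (X (t + 1) b.proc) := by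
  obtain ⟨⟨a, e⟩, hg, hb⟩ := view_eq_some.1 h
  obtain rfl : e = _ := racEvent_eq_some.1 hb
  obtain ⟨p, hp, -⟩ := T.step t _ hg
  obtain rfl := hp.rac_proc
  exact ⟨a, hg, hp⟩

theorem rac_response {t : ℕ} {p : P} {l : Lap}
    (h : view racEvent G t = some (Label.step p (some l))) :
    ∃ c s op, X t p = ⟨c, s, Pc.entering op⟩ ∧ X (t + 1) p = ⟨some l, s, Pc.test op⟩ := by
  obtain ⟨a, -, hs⟩ := T.rac_step h
  simp only [Label.proc] at hs
  generalize hx : X t p = x at hs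
  generalize hy : X (t + 1) p = y at hs
  cases hs
  exact ⟨_, _, _, rfl, rfl⟩

theorem rac_invoke {t : ℕ} {p : P} (h : view racEvent G t = some (Label.inv p ())) :
    ∃ c s op, X t p = ⟨c, s, Pc.enter op⟩ ∧ X (t + 1) p = ⟨c, s, Pc.entering op⟩ := by
  obtain ⟨a, -, hs⟩ := T.rac_step h
  simp only [Label.proc] at hs
  generalize hx : X t p = x at hs
  generalize hy : X (t + 1) p = y at hs
  cases hs
  exact ⟨_, _, _, rfl, rfl⟩

theorem propose_invoke {t : ℕ} {p : P} {l : Lap} {u : S × P}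
    (h : view (consEvent l) G t = some (Label.inv p (ConsOp.propose u))) :
    ∃ s op, X t p = ⟨some l, s, Pc.compute op⟩ ∧ (τ s op).1 ≠ s ∧ u = ((τ s op).1, p) ∧
      X (t + 1) p = ⟨some l, s, Pc.proposing op (τ s op).2⟩ ∧
      (G.map Prod.fst)[t]? = some (Label.step p none) := by
  obtain ⟨a, hg, hs⟩ := T.cons_step h
  simp only [Label.proc] at hs
  generalize hx : X t p = x at hs
  generalize hy : X (t + 1) p = y at hs
  cases hs
  exact ⟨_, _, rfl, by assumption, rfl, rfl, by simp [hg]⟩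

theorem op_start {t : ℕ} (ht : t ≤ G.length) {p : P} {op : Op}
    (h : (X t p).pc.op? = some op) :
    ∃ i < t, (G.map Prod.fst)[i]? = some (Label.inv p op) ∧ (X i p).pc = Pc.idle ∧
      ∀ m, i < m → m ≤ t → (X m p).pc.op? = some op := by
  obtain ⟨m, a, e, -, hm, hn, hall, hg, hs⟩ := T.exists_entry p (fun x => x.pc.op? = some op)
    (Nat.zero_le t) ht (by simp [T.init, Pc.op?]) h
  have h1 := hall (m + 1) (by omega) (by omega)
  refine ⟨m, hm, ?_, ?_, hall⟩ <;>
  · generalize hx : X m p = x at hs hn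
    generalize hy : X (m + 1) p = y at hs h1
    cases hs
    case inv c s op' =>
      rcases c with _ | c <;> simp_all [Pc.op?]
    all_goals simp_all [Pc.op?]

theorem reading_start {t : ℕ} (ht : t ≤ G.length) {p : P} {l : Lap} {s : S} {op : Op}
    (h : X t p = ⟨some l, s, Pc.reading op⟩) :
    ∃ i < t, X i p = ⟨some l, s, Pc.test op⟩ ∧
      view (consEvent l) G i = some (Label.inv p ConsOp.read) ∧
      ∀ m, i < m → m ≤ t → X m p = ⟨some l, s, Pc.reading op⟩ := by
  obtain ⟨m, a, e, -, hm, hn, hall, hg, hs⟩ :=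
    T.exists_entry p (fun x => x = ⟨some l, s, Pc.reading op⟩)
    (Nat.zero_le t) ht (by simp [T.init]) h
  have h1 := hall (m + 1) (by omega) (by omega)
  refine ⟨m, hm, ?_, ?_, hall⟩ <;>
  · generalize hx : X m p = x at hs hn
    generalize hy : X (m + 1) p = y at hs h1
    cases hs
    case inv c s op' => rcases c with _ | c <;> simp_all
    all_goals simp_all [view]

/-- A read in progress that returns at time `t`. -/
theorem completesAt_read {t : ℕ} {p : P} {l : Lap} {s : S} {op : Op} {d : Option (S × P)}
    (h : X t p = ⟨some l, s, Pc.reading op⟩)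
    (hv : view (consEvent l) G t = some (Label.step p (some d))) :
    ∃ i < t, X i p = ⟨some l, s, Pc.test op⟩ ∧
      CompletesAt (view (consEvent l) G) i t p ConsOp.read d ∧
      ∀ m, i < m → m ≤ t → X m p = ⟨some l, s, Pc.reading op⟩ := by
  obtain ⟨i, hi, hx, hvi, hall⟩ := T.reading_start (view_lt_length hv).le h
  refine ⟨i, hi, hx, ⟨hi, hvi, hv, fun k hik hkt r hr => ?_⟩, hall⟩
  obtain ⟨a, -, hs⟩ := T.cons_step hr
  simp only [Label.proc, hall k hik hkt.le, hall (k + 1) (by omega) hkt] at hs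
  cases hs

theorem compute_start {t : ℕ} (ht : t ≤ G.length) {p : P} {l : Lap} {s : S} {op : Op}
    (h : X t p = ⟨some l, s, Pc.compute op⟩) :
    ∃ i j, j < t ∧ X i p = ⟨some l, s, Pc.test op⟩ ∧
      CompletesAt (view (consEvent l) G) i j p ConsOp.read none ∧
      ∀ m, i < m → m ≤ t →
        X m p = ⟨some l, s, Pc.reading op⟩ ∨ X m p = ⟨some l, s, Pc.compute op⟩ := by
  obtain ⟨m, a, e, -, hm, hn, hall, hg, hs⟩ :=
    T.exists_entry p (fun x => x = ⟨some l, s, Pc.compute op⟩)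
    (Nat.zero_le t) ht (by simp [T.init]) h
  have h1 := hall (m + 1) (by omega) (by omega)
  have : X m p = ⟨some l, s, Pc.reading op⟩ ∧
      view (consEvent l) G m = some (Label.step p (some none)) := by
    generalize hx : X m p = x at hs hn
    generalize hy : X (m + 1) p = y at hs h1
    cases hs
    case inv c s op' => rcases c with _ | c <;> simp_all
    all_goals simp_all [view]
  obtain ⟨i, hi, hx, hc, hall'⟩ := T.completesAt_read this.1 this.2
  refine ⟨i, m, hm, hx, hc, fun m' h1 h2 => ?_⟩
  rcases Nat.lt_or_ge m m' with h3 | h3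
  · exact Or.inr (hall m' h3 h2)
  · exact Or.inl (hall' m' h1 h3)

theorem proposing_start {t : ℕ} (ht : t ≤ G.length) {p : P} {l : Lap} {s : S} {op : Op} {v : Res}
    (h : X t p = ⟨some l, s, Pc.proposing op v⟩) :
    ∃ i < t, X i p = ⟨some l, s, Pc.compute op⟩ ∧
      view (consEvent l) G i = some (Label.inv p (ConsOp.propose ((τ s op).1, p))) ∧
      v = (τ s op).2 ∧ ∀ m, i < m → m ≤ t → X m p = ⟨some l, s, Pc.proposing op v⟩ := by
  obtain ⟨m, a, e, -, hm, hn, hall, hg, hs⟩ :=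
    T.exists_entry p (fun x => x = ⟨some l, s, Pc.proposing op v⟩)
    (Nat.zero_le t) ht (by simp [T.init]) h
  have h1 := hall (m + 1) (by omega) (by omega)
  refine ⟨m, hm, ?_, ?_, ?_, hall⟩ <;>
  · generalize hx : X m p = x at hs hn
    generalize hy : X (m + 1) p = y at hs h1
    cases hs
    case inv c s op' => rcases c with _ | c <;> simp_all
    all_goals simp_all [view] <;> grind

/-- A proposal in progress that returns at time `t`. -/
theorem completesAt_propose {t : ℕ} {p : P} {l : Lap} {s : S} {op : Op} {v : Res}
    {d : Option (S × P)} (h : X t p = ⟨some l, s, Pc.proposing op v⟩)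
    (hv : view (consEvent l) G t = some (Label.step p (some d))) :
    ∃ i < t, X i p = ⟨some l, s, Pc.compute op⟩ ∧ v = (τ s op).2 ∧
      CompletesAt (view (consEvent l) G) i t p (ConsOp.propose ((τ s op).1, p)) d ∧
      ∀ m, i < m → m ≤ t → X m p = ⟨some l, s, Pc.proposing op v⟩ := by
  obtain ⟨i, hi, hx, hvi, hv', hall⟩ := T.proposing_start (view_lt_length hv).le h
  refine ⟨i, hi, hx, hv', ⟨hi, hvi, hv, fun k hik hkt r hr => ?_⟩, hall⟩
  obtain ⟨a, -, hs⟩ := T.cons_step hr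
  simp only [Label.proc, hall k hik hkt.le, hall (k + 1) (by omega) hkt] at hs
  cases hs

/-- With a current lap, the program counter `enter` is reached only by reading a decision, and the
local state is then copied from that decision. -/
theorem enter_start {t : ℕ} (ht : t ≤ G.length) {p : P} {l : Lap} {s : S} {op : Op}
    (h : X t p = ⟨some l, s, Pc.enter op⟩) :
    ∃ i j q, j < t ∧ CompletesAt (view (consEvent l) G) i j p ConsOp.read (some (s, q)) := by
  obtain ⟨m, a, e, -, hm, hn, hall, hg, hs⟩ :=
    T.exists_entry p (fun x => x = ⟨some l, s, Pc.enter op⟩)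
    (Nat.zero_le t) ht (by simp [T.init]) h
  have h1 := hall (m + 1) (by omega) (by omega)
  have : ∃ s' q, X m p = ⟨some l, s', Pc.reading op⟩ ∧
      view (consEvent l) G m = some (Label.step p (some (some (s, q)))) := by
    generalize hx : X m p = x at hs hn
    generalize hy : X (m + 1) p = y at hs h1
    cases hs
    case inv c s op' => rcases c with _ | c <;> simp_all
    case readSome l' s' op' d =>
      obtain ⟨d, q⟩ := d
      refine ⟨s', q, ?_⟩
      simp_all [view]
    all_goals simp_all
  obtain ⟨s', q, hx, hv⟩ := this
  obtain ⟨i, -, -, hc, -⟩ := T.completesAt_read hx hv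
  exact ⟨i, m, q, hm, hc⟩

theorem entering_start {t : ℕ} (ht : t ≤ G.length) {p : P} {c : Option Lap} {s : S} {op : Op}
    (h : X t p = ⟨c, s, Pc.entering op⟩) :
    ∃ i < t, X i p = ⟨c, s, Pc.enter op⟩ ∧
      view racEvent G i = some (Label.inv p ()) ∧
      ∀ m, i < m → m ≤ t → X m p = ⟨c, s, Pc.entering op⟩ := by
  obtain ⟨m, a, e, -, hm, hn, hall, hg, hs⟩ :=
    T.exists_entry p (fun x => x = ⟨c, s, Pc.entering op⟩)
    (Nat.zero_le t) ht (by simp [T.init]) h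
  have h1 := hall (m + 1) (by omega) (by omega)
  refine ⟨m, hm, ?_, ?_, hall⟩ <;>
  · generalize hx : X m p = x at hs hn
    generalize hy : X (m + 1) p = y at hs h1
    cases hs
    case inv c s op' => rcases c with _ | c <;> simp_all
    all_goals simp_all [view]

/-- A call to `enter` in progress that returns at time `t`. -/
theorem completesAt_enter {t : ℕ} {p : P} {l : Lap} {c : Option Lap} {s : S} {op : Op}
    (h : X t p = ⟨c, s, Pc.entering op⟩)
    (hv : view racEvent G t = some (Label.step p (some l))) :
    ∃ i < t, X i p = ⟨c, s, Pc.enter op⟩ ∧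
      CompletesAt (view racEvent G) i t p () l := by
  obtain ⟨i, hi, hx, hvi, hall⟩ := T.entering_start (view_lt_length hv).le h
  refine ⟨i, hi, hx, hi, hvi, hv, fun k hik hkt r hr => ?_⟩
  obtain ⟨a, -, hs⟩ := T.rac_step hr
  simp only [Label.proc, hall k hik hkt.le, hall (k + 1) (by omega) hkt] at hs
  cases hs

/-- The entry into the current lap of a process that is not about to leave it. -/
theorem visit_start {t : ℕ} (ht : t ≤ G.length) {p : P} {l : Lap} {s : S}
    (hc : (X t p).cur = some l) (hs : (X t p).st = s)
    (h1 : ∀ op, (X t p).pc ≠ Pc.enter op) (h2 : ∀ op, (X t p).pc ≠ Pc.entering op) :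
    ∃ i j c op, j < t ∧ CompletesAt (view racEvent G) i j p () l ∧ X i p = ⟨c, s, Pc.enter op⟩ ∧
      ∀ m, j < m → m ≤ t → (X m p).cur = some l := by
  -- The local state is constant during a visit: reading a decision changes it, but also moves to
  -- `enter`, where the predicate fails. So the predicate can only become true with a response of
  -- the racing, and the state at that moment is the one with which the call was made.
  obtain ⟨m, a, e, -, hm, hn, hall, hg, hst⟩ :=
    T.exists_entry p (fun x => x.cur = some l ∧ x.st = s ∧ (∀ op, x.pc ≠ Pc.enter op) ∧
      ∀ op, x.pc ≠ Pc.entering op)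
    (Nat.zero_le t) ht (by simp [T.init]) ⟨hc, hs, h1, h2⟩
  have h1 := hall (m + 1) (by omega) (by omega)
  have : ∃ c op, X m p = ⟨c, s, Pc.entering op⟩ ∧
      view racEvent G m = some (Label.step p (some l)) := by
    generalize hx : X m p = x at hst hn
    generalize hy : X (m + 1) p = y at hst h1
    cases hst <;> simp_all [view]
  obtain ⟨c, op, hx, hv⟩ := this
  obtain ⟨i, -, hi, hcm⟩ := T.completesAt_enter hx hv
  exact ⟨i, m, c, op, hm, hcm, hi, fun m' h1 h2 => (hall m' h1 h2).1⟩

/-- A process that is about to leave a lap entered it with its preceding call. -/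
theorem enter_justLeft {t : ℕ} (ht : t ≤ G.length) {p : P} {l : Lap} {s : S} {op : Op}
    (h : X t p = ⟨some l, s, Pc.enter op⟩) :
    ∃ i j, CompletesAt (view racEvent G) i j p () l ∧ j < t ∧
      ∀ k, j < k → k < t → ∀ l', view racEvent G k ≠ some (Label.step p (some l')) := by
  obtain ⟨m, a, e, -, hm, hn, hall, hg, hst⟩ :=
    T.exists_entry p (fun x => x.cur = some l ∧ ∀ op, x.pc ≠ Pc.entering op)
    (Nat.zero_le t) ht (by simp [T.init]) (by simp [h])
  have h1 := hall (m + 1) (by omega) (by omega)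
  have : ∃ c s op, X m p = ⟨c, s, Pc.entering op⟩ ∧
      view racEvent G m = some (Label.step p (some l)) := by
    generalize hx : X m p = x at hst hn
    generalize hy : X (m + 1) p = y at hst h1
    cases hst <;> simp_all [view]
  obtain ⟨c, s, op, hx, hv⟩ := this
  obtain ⟨i, -, -, hcm⟩ := T.completesAt_enter hx hv
  refine ⟨i, m, hcm, hm, fun k h1 h2 l' hr => ?_⟩
  obtain ⟨c, s, op, hk, -⟩ := T.rac_response hr
  exact (hall k h1 h2.le).2 op (by simp [hk])

/-- The local state is assigned only from a decision register, and reading one requires a current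
lap. -/
theorem st_of_cur_none {t : ℕ} (ht : t ≤ G.length) {p : P} (h : (X t p).cur = none) :
    (X t p).st = s₀ ∧ ((X t p).pc = Pc.idle ∨ (∃ op, (X t p).pc = Pc.enter op) ∨
      ∃ op, (X t p).pc = Pc.entering op) := by
  induction t with
  | zero => simp [T.init]
  | succ t ih =>
    rcases T.eq_or_localStep (t := t) (by omega) p with hs | hs
    · rw [hs] at h ⊢
      exact ih (by omega) h
    · generalize hx : X t p = x at hs
      generalize hy : X (t + 1) p = y at hs
      generalize G[t].1 = a at hs
      generalize G[t].2 = e at hs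
      have ih := ih (by omega)
      cases hs <;> simp_all

theorem rac_response_cur {j t : ℕ} (ht : t ≤ G.length) (hjt : j < t) {p : P} {l : Lap}
    (h : view racEvent G j = some (Label.step p (some l))) : (X t p).cur ≠ none := by
  obtain ⟨c, s, op, -, h1⟩ := T.rac_response h
  by_contra hn
  obtain ⟨m, a, e, hm, -, hq, hall, -, hs⟩ := T.exists_exit p (fun x => x.cur ≠ none)
    (k := j + 1) hjt ht (by simp [h1]) (not_not.2 hn)
  have h2 := hall m hm le_rfl
  generalize hx : X m p = x at hs h2
  generalize hy : X (m + 1) p = y at hs hq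
  cases hs <;> simp_all

end Trace

end Trace

/-! ## Executions of the universal construction and of its base objects -/

/-- The event may lead from the first state to the second one, if processes are well-behaved. -/
def Impl.Transition {P Op Res : Type*} (A : Impl P Op Res) :
    Label P Op Res → A.State → A.State → Prop
  | Label.inv p op, σ, σ' => σ' = A.invoke p op σ
  | Label.step p o, σ, σ' => (σ', o) ∈ A.step p σ

section Simulation

variable {P Lap S Op Res : Type*} {τ : S → Op → S × Res} {s₀ : S} {R : Impl P Unit Lap}
  {C : Lap → Impl P (ConsOp (S × P)) (Option (S × P))}

/-- A step of the universal construction, with the event `e` on a base object. -/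
structure UStep (τ : S → Op → S × Res) (σ : UState R C Op Res) (a : Label P Op Res)
    (e : BaseEvent P Lap S) (σ' : UState R C Op Res) : Prop where
  loc : ∃ p, LocalStep τ p (σ.loc p) a e (σ'.loc p) ∧ ∀ q, q ≠ p → σ'.loc q = σ.loc q
  rac : ∀ b, e = BaseEvent.rac b → R.Transition b σ.rac σ'.rac
  rac_frame : (∀ b, e ≠ BaseEvent.rac b) → σ'.rac = σ.rac
  cons : ∀ l b, e = BaseEvent.cons l b → (C l).Transition b (σ.cons l) (σ'.cons l)
  cons_frame : ∀ l, (∀ b, e ≠ BaseEvent.cons l b) → σ'.cons l = σ.cons l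

theorem UState.setLoc_self (σ : UState R C Op Res) (p : P) : σ.setLoc p (σ.loc p) = σ := by
  simp [UState.setLoc]

theorem UStep.of_silent {σ : UState R C Op Res} {p : P} {a : Label P Op Res}
    {x : Loc Lap S Op Res} (h : LocalStep τ p (σ.loc p) a BaseEvent.silent x) :
    UStep τ σ a BaseEvent.silent (σ.setLoc p x) where
  loc := ⟨p, by simpa [UState.setLoc] using h, fun q hq => by simp [UState.setLoc, hq]⟩
  rac := by simp
  rac_frame _ := rfl
  cons := by simp
  cons_frame _ _ := rfl

theorem UStep.of_rac {σ : UState R C Op Res} {p : P} {a : Label P Op Res}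
    {b : Label P Unit Lap} {x : Loc Lap S Op Res} {y : R.State}
    (h : LocalStep τ p (σ.loc p) a (BaseEvent.rac b) x) (hb : R.Transition b σ.rac y) :
    UStep τ σ a (BaseEvent.rac b) ((σ.setRac y).setLoc p x) where
  loc := ⟨p, by simpa [UState.setLoc] using h,
    fun q hq => by simp [UState.setLoc, UState.setRac, hq]⟩
  rac := by rintro _ ⟨⟩; exact hb
  rac_frame h := absurd rfl (h b)
  cons := by simp
  cons_frame _ _ := rfl

theorem UStep.of_cons {σ : UState R C Op Res} {p : P} {a : Label P Op Res} {l : Lap}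
    {b : Label P (ConsOp (S × P)) (Option (S × P))} {x : Loc Lap S Op Res} {y : (C l).State}
    (h : LocalStep τ p (σ.loc p) a (BaseEvent.cons l b) x)
    (hb : (C l).Transition b (σ.cons l) y) :
    UStep τ σ a (BaseEvent.cons l b) ((σ.setCons l y).setLoc p x) where
  loc := ⟨p, by simpa [UState.setLoc] using h,
    fun q hq => by simp [UState.setLoc, UState.setCons, hq]⟩
  rac := by simp
  rac_frame _ := rfl
  cons := by
    rintro _ _ ⟨⟩
    simpa [UState.setLoc, UState.setCons] using hb
  cons_frame l' h' := by
    have : l' ≠ l := by rintro rfl; exact h' b rfl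
    simp [UState.setLoc, UState.setCons, this]

theorem uStep_invoke {σ : UState R C Op Res} {p : P} (hp : (σ.loc p).pc = Pc.idle) (op : Op) :
    UStep τ σ (Label.inv p op) BaseEvent.silent ((runiv τ s₀ R C).invoke p op σ) := by
  apply UStep.of_silent
  generalize σ.loc p = x at hp
  obtain ⟨c, s, _⟩ := x
  subst hp
  exact LocalStep.inv c s op

/-- The hypotheses on the program counter and on the current lap exclude the last case of
`runivStep`, which corresponds to no `LocalStep`. -/
theorem exists_uStep {σ σ' : UState R C Op Res} {p : P} {o : Option Res}
    (hp : (σ.loc p).pc ≠ Pc.idle)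
    (hc : (σ.loc p).cur = none → (σ.loc p).pc = Pc.idle ∨ (∃ op, (σ.loc p).pc = Pc.enter op) ∨
      ∃ op, (σ.loc p).pc = Pc.entering op)
    (h : (σ', o) ∈ (runiv τ s₀ R C).step p σ) : ∃ e, UStep τ σ (Label.step p o) e σ' := by
  change (σ', o) ∈ runivStep τ p σ at h
  rcases hx : σ.loc p with ⟨c, s, pc⟩
  rw [hx] at hp hc
  -- Internal steps of a base object do not assign local variables; writing them as a trivial
  -- assignment brings them to the form expected by `UStep.of_rac` and `UStep.of_cons`.
  have hself : ∀ σ₁ : UState R C Op Res, σ₁.loc = σ.loc → σ₁ = σ₁.setLoc p ⟨c, s, pc⟩ := by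
    intro σ₁ h
    rw [← hx, ← h, σ₁.setLoc_self]
  rcases pc with _ | op | op | op | op | op | ⟨op, v⟩
  · exact absurd rfl hp
  · simp only [runivStep, hx, Set.mem_singleton_iff, Prod.mk.injEq] at h
    obtain ⟨rfl, rfl⟩ := h
    exact ⟨_, UStep.of_rac (b := Label.inv p ()) (by rw [hx]; exact LocalStep.enter c s op) rfl⟩
  · simp only [runivStep, hx] at h
    obtain ⟨⟨y, o'⟩, hy, h⟩ := h
    rcases o' with _ | l <;> simp only [afterEnter, Prod.mk.injEq] at h <;> obtain ⟨rfl, rfl⟩ := h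
    · rw [hself (σ.setRac y) rfl]
      exact ⟨_, UStep.of_rac (b := Label.step p none)
        (by rw [hx]; exact LocalStep.entering c s op) hy⟩
    · rw [hx]
      exact ⟨_, UStep.of_rac (b := Label.step p (some l))
        (by rw [hx]; exact LocalStep.entered c s op l) hy⟩
  all_goals
    rcases c with _ | l
    · simp at hc
    simp only [runivStep, hx] at h
  · simp only [Set.mem_singleton_iff, Prod.mk.injEq] at h
    obtain ⟨rfl, rfl⟩ := h
    exact ⟨_, UStep.of_cons (b := Label.inv p ConsOp.read)
      (by rw [hx]; exact LocalStep.test l s op) rfl⟩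
  · obtain ⟨⟨y, o'⟩, hy, h⟩ := h
    rcases o' with _ | _ | d <;> simp only [afterRead, Prod.mk.injEq] at h <;>
      obtain ⟨rfl, rfl⟩ := h
    · rw [hself (σ.setCons l y) rfl]
      exact ⟨_, UStep.of_cons (b := Label.step p none)
        (by rw [hx]; exact LocalStep.reading l s op) hy⟩
    · rw [hx]
      exact ⟨_, UStep.of_cons (b := Label.step p (some none))
        (by rw [hx]; exact LocalStep.readNone l s op) hy⟩
    · exact ⟨_, UStep.of_cons (b := Label.step p (some (some d)))
        (by rw [hx]; exact LocalStep.readSome l s op d) hy⟩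
  · simp only [Set.mem_singleton_iff, doCompute] at h
    rw [hx] at h
    split_ifs at h with hτ <;> simp only [Prod.mk.injEq] at h <;> obtain ⟨rfl, rfl⟩ := h
    · exact ⟨_, UStep.of_silent (by rw [hx]; exact LocalStep.ret l s op hτ)⟩
    · exact ⟨_, UStep.of_cons (b := Label.inv p (ConsOp.propose ((τ s op).1, p)))
        (by rw [hx]; exact LocalStep.propose l s op hτ) rfl⟩
  · obtain ⟨⟨y, o'⟩, hy, h⟩ := h
    rcases o' with _ | d
    · simp only [afterPropose, Prod.mk.injEq] at h
      obtain ⟨rfl, rfl⟩ := h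
      rw [hself (σ.setCons l y) rfl]
      exact ⟨_, UStep.of_cons (b := Label.step p none)
        (by rw [hx]; exact LocalStep.proposing l s op v) hy⟩
    · simp only [afterPropose, hx] at h
      split_ifs at h with hd <;> simp only [Prod.mk.injEq] at h <;> obtain ⟨rfl, rfl⟩ := h
      · exact ⟨_, UStep.of_cons (b := Label.step p (some d))
          (by rw [hx]; exact LocalStep.win l s op v d hd) hy⟩
      · exact ⟨_, UStep.of_cons (b := Label.step p (some d))
          (by rw [hx]; exact LocalStep.lose l s op v d hd) hy⟩

/-- The events `G` lead through the local states `X t` to the state `σ`. -/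
structure Exec (τ : S → Op → S × Res) (s₀ : S) (G : List (Event P Lap S Op Res))
    (X : ℕ → P → Loc Lap S Op Res) (σ : UState R C Op Res) : Prop where
  trace : Trace τ s₀ G X
  loc : X G.length = σ.loc
  rac : R.Run (G.filterMap racEvent) σ.rac
  cons : ∀ l, (C l).Run (G.filterMap (consEvent l)) (σ.cons l)
  racBusy : ∀ p, Busy (G.filterMap racEvent) p ↔ ∃ op, (σ.loc p).pc = Pc.entering op
  consBusy : ∀ p l, Busy (G.filterMap (consEvent l)) p ↔ (σ.loc p).cur = some l ∧
    ((∃ op, (σ.loc p).pc = Pc.reading op) ∨ ∃ op v, (σ.loc p).pc = Pc.proposing op v)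
  busy : ∀ p, Busy (G.map Prod.fst) p ↔ (σ.loc p).pc ≠ Pc.idle

theorem Exec.nil : Exec τ s₀ [] (fun _ _ => ⟨none, s₀, Pc.idle⟩)
    ((runiv τ s₀ R C : Impl P Op Res).init : UState R C Op Res) where
  trace := ⟨rfl, by simp⟩
  loc := rfl
  rac := Impl.Run.nil
  cons _ := Impl.Run.nil
  racBusy p := by simp [not_busy_nil, runiv]
  consBusy p l := by simp [not_busy_nil, runiv]
  busy p := by simp [not_busy_nil, runiv]

/-- The equivalences between `Busy` and the program counter are the invariant that makes the
filtered lists genuine runs: a base object is invoked only when idle and stepped only when busy. The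
function `X'` is given from outside, so that a single one can serve all prefixes of an infinite run.
-/
theorem Exec.snoc {G : List (Event P Lap S Op Res)} {X : ℕ → P → Loc Lap S Op Res}
    {σ σ' : UState R C Op Res} (E : Exec τ s₀ G X σ) {a : Label P Op Res} {e : BaseEvent P Lap S}
    (h : UStep τ σ a e σ') {X' : ℕ → P → Loc Lap S Op Res}
    (hX' : ∀ t ≤ G.length, X' t = X t) (hX'' : X' (G.length + 1) = σ'.loc) :
    Exec τ s₀ (G ++ [(a, e)]) X' σ' := by
  obtain ⟨p, hp, hq⟩ := h.loc
  constructor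
  · constructor
    · rw [hX' 0 (Nat.zero_le _), E.trace.init]
    · intro t g hg
      have hlt := (List.getElem?_eq_some_iff.1 hg).1
      rcases Nat.lt_or_ge t G.length with ht | ht
      · rw [List.getElem?_append_left ht] at hg
        rw [hX' t ht.le, hX' (t + 1) ht]
        exact E.trace.step t g hg
      · obtain rfl : t = G.length := by simp at hlt; omega
        obtain rfl : (a, e) = g := by simpa using hg
        rw [hX' _ le_rfl, hX'', E.loc]
        exact ⟨p, hp, hq⟩
  · simpa using hX''
  · rcases e with _ | b | ⟨l, b⟩
    · simpa [h.rac_frame (by simp), List.filterMap_cons] using E.rac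
    · have hb := h.rac b rfl
      simp only [List.filterMap_append, List.filterMap_cons, racEvent_rac, List.filterMap_nil]
      refine E.rac.snoc ?_
      have hbp := hp.rac_proc
      have hB := E.racBusy p
      generalize σ.loc p = x at hp hB
      generalize σ'.loc p = x' at hp
      rcases b with ⟨q, u⟩ | ⟨q, o⟩ <;> obtain rfl : q = p := hbp <;> refine ⟨?_, hb⟩ <;>
        rw [hB] <;> cases hp <;> simp
    · simpa [h.rac_frame (by simp), List.filterMap_cons] using E.rac
  · intro l
    rcases e with _ | b | ⟨l', b⟩
    · simpa [h.cons_frame l (by simp), List.filterMap_cons] using E.cons l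
    · simpa [h.cons_frame l (by simp), List.filterMap_cons] using E.cons l
    · by_cases hl : l' = l
      · subst hl
        have hb := h.cons l' b rfl
        simp only [List.filterMap_append, List.filterMap_cons, consEvent_cons_self,
          List.filterMap_nil]
        refine (E.cons l').snoc ?_
        have hbp := hp.cons_proc
        have hB := E.consBusy p l'
        generalize σ.loc p = x at hp hB
        generalize σ'.loc p = x' at hp
        rcases b with ⟨q, u⟩ | ⟨q, o⟩ <;> obtain rfl : q = p := hbp <;> refine ⟨?_, hb⟩ <;>
          rw [hB] <;> cases hp <;> simp
      · rw [h.cons_frame l (by simpa using hl)]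
        simpa [consEvent, hl] using E.cons l
  · intro q
    rw [List.filterMap_append]
    by_cases hqp : q = p
    · subst hqp
      have hB := E.racBusy q
      generalize σ.loc q = x at hp hB
      generalize σ'.loc q = x' at hp
      cases hp
      case inv c s op => rcases c with _ | c <;> simp [List.filterMap_cons, hB]
      all_goals simp [List.filterMap_cons, busy_append_singleton, hB]
    · rw [hq q hqp, ← E.racBusy q]
      rcases e with _ | b | ⟨l, b⟩
      · simp [List.filterMap_cons]
      · have hbp := hp.rac_proc
        rcases b with ⟨p', u⟩ | ⟨p', o⟩ <;> obtain rfl : p' = p := hbp <;>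
          simp [busy_append_singleton, Ne.symm hqp]
      · simp [List.filterMap_cons]
  · intro q l
    rw [List.filterMap_append]
    by_cases hqp : q = p
    · subst hqp
      have hB := E.consBusy q l
      generalize σ.loc q = x at hp hB
      generalize σ'.loc q = x' at hp
      cases hp
      case inv c s op => rcases c with _ | c <;> simp [List.filterMap_cons, hB]
      case test l' s op =>
        by_cases hl : l' = l
        · subst hl; simp [busy_append_singleton]
        · simp [consEvent, hl, hB]
      case reading l' s op =>
        by_cases hl : l' = l
        · subst hl; simp [busy_append_singleton, hB]
        · simp [consEvent, hl, hB]
      case readNone l' s op =>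
        by_cases hl : l' = l
        · subst hl; simp [busy_append_singleton]
        · simp [consEvent, hl, hB]
      case readSome l' s op d =>
        by_cases hl : l' = l
        · subst hl; simp [busy_append_singleton]
        · simp [consEvent, hl, hB]
      case propose l' s op _ =>
        by_cases hl : l' = l
        · subst hl; simp [busy_append_singleton]
        · simp [consEvent, hl, hB]
      case proposing l' s op _ =>
        by_cases hl : l' = l
        · subst hl; simp [busy_append_singleton, hB]
        · simp [consEvent, hl, hB]
      case win l' s op _ _ _ =>
        by_cases hl : l' = l
        · subst hl; simp [busy_append_singleton]
        · simp [consEvent, hl, hB]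
      case lose l' s op _ _ _ =>
        by_cases hl : l' = l
        · subst hl; simp [busy_append_singleton]
        · simp [consEvent, hl, hB]
      all_goals simp [List.filterMap_cons, hB]
    · rw [hq q hqp, ← E.consBusy q l]
      rcases e with _ | b | ⟨l', b⟩
      · simp [List.filterMap_cons]
      · simp [List.filterMap_cons]
      · by_cases hl : l' = l
        · subst hl
          have hbp := hp.cons_proc
          rcases b with ⟨p', u⟩ | ⟨p', o⟩ <;> obtain rfl : p' = p := hbp <;>
            simp [busy_append_singleton, Ne.symm hqp]
        · simp [consEvent, hl]
  · intro q
    rw [List.map_append, List.map_singleton, busy_append_singleton, E.busy q]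
    by_cases hqp : q = p
    · subst hqp
      generalize σ.loc q = x at hp
      generalize σ'.loc q = x' at hp
      cases hp
      case inv c s op => rcases c with _ | c <;> simp
      all_goals simp
    · rw [hq q hqp]
      have hap := hp.proc_eq
      rcases a with ⟨p', u⟩ | ⟨p', o⟩ <;> obtain rfl : p' = p := hap <;> simp [Ne.symm hqp]

theorem Exec.exists_snoc {G : List (Event P Lap S Op Res)} {X : ℕ → P → Loc Lap S Op Res}
    {σ σ' : UState R C Op Res} (E : Exec τ s₀ G X σ) {a : Label P Op Res} {e : BaseEvent P Lap S}
    (h : UStep τ σ a e σ') : ∃ X', Exec τ s₀ (G ++ [(a, e)]) X' σ' :=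
  ⟨fun t => if t ≤ G.length then X t else σ'.loc,
    E.snoc h (fun t ht => if_pos ht) (if_neg (by omega))⟩

theorem Exec.wellFormed {G : List (Event P Lap S Op Res)} {X : ℕ → P → Loc Lap S Op Res}
    {σ : UState R C Op Res} (E : Exec τ s₀ G X σ) (p : P) (h : (σ.loc p).cur = none) :
    (σ.loc p).pc = Pc.idle ∨ (∃ op, (σ.loc p).pc = Pc.enter op) ∨
      ∃ op, (σ.loc p).pc = Pc.entering op := by
  rw [← E.loc] at h ⊢
  exact (E.trace.st_of_cur_none le_rfl h).2

/-- This replaces runs by traces, in which the states of the base objects play no role any more: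
only their histories do. -/
theorem exists_exec {h : List (Label P Op Res)} {σ : (runiv τ s₀ R C : Impl P Op Res).State}
    (hr : (runiv τ s₀ R C).Run h σ) : ∃ G X, Exec τ s₀ G X σ ∧ G.map Prod.fst = h := by
  induction hr with
  | nil => exact ⟨[], _, Exec.nil, rfl⟩
  | @snoc h σ a σ' _ hn ih =>
    obtain ⟨G, X, E, rfl⟩ := ih
    rcases a with ⟨p, op⟩ | ⟨p, o⟩
    · obtain ⟨hb, rfl⟩ := hn
      rw [E.busy p, not_not] at hb
      obtain ⟨X', E'⟩ := E.exists_snoc (uStep_invoke hb op)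
      exact ⟨_, X', E', by simp⟩
    · obtain ⟨hb, hs⟩ := hn
      rw [E.busy p] at hb
      obtain ⟨e, he⟩ := exists_uStep hb (E.wellFormed p) hs
      obtain ⟨X', E'⟩ := E.exists_snoc he
      exact ⟨_, X', E', by simp⟩

end Simulation

/-! ## Base objects in the time of the universal construction -/

section RacingAt

variable {P Lap : Type*}

/-- `Entered`, for a history in which some positions carry no event. -/
def EnteredAt (e : ℕ → Option (Label P Unit Lap)) (l : Lap) : Prop :=
  ∃ i j p, CompletesAt e i j p () l

/-- `LeftBefore`, for a history in which some positions carry no event. -/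
def LeftBeforeAt (e : ℕ → Option (Label P Unit Lap)) (l : Lap) (t : ℕ) : Prop :=
  ∃ i j q k, CompletesAt e i j q () l ∧ j < k ∧ k < t ∧ e k = some (Label.inv q ())

/-- `JustLeft`, for a history in which some positions carry no event. -/
def JustLeftAt (e : ℕ → Option (Label P Unit Lap)) (p : P) (t : ℕ) (l : Lap) : Prop :=
  ∃ i j, CompletesAt e i j p () l ∧ j < t ∧
    ∀ k, j < k → k < t → ∀ l', e k ≠ some (Label.step p (some l'))

/-- `IsPredLap`, for a history in which some positions carry no event. -/
def IsPredLapAt (lt : Lap → Lap → Prop) (e : ℕ → Option (Label P Unit Lap))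
    (l' l : Lap) : Prop :=
  EnteredAt e l' ∧ lt l' l ∧ ∀ l'', EnteredAt e l'' → ¬ (lt l' l'' ∧ lt l'' l)

/-- The order `lt` on laps witnesses that the history is one of a racing. -/
structure IsRacingOrder (lt : Lap → Lap → Prop) (e : ℕ → Option (Label P Unit Lap)) : Prop where
  sto : IsStrictTotalOrder Lap lt
  new : ∀ {i j p l}, CompletesAt e i j p () l → ∀ {i' j'}, CompletesAt e i' j' p () l → i' = i
  pred : ∀ {i j p l}, CompletesAt e i j p () l →
    LeftBeforeAt e l j ∨ ∀ l', IsPredLapAt lt e l' l → JustLeftAt e p i l'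

theorem filteredPos_inj {α β : Type*} {f : α → Option β} {G : List α} {s t : ℕ} {b c : β}
    (hs : view f G s = some b) (ht : view f G t = some c)
    (h : filteredPos f G s = filteredPos f G t) : s = t := by
  rcases lt_trichotomy s t with hst | hst | hst
  · have := filteredPos_lt hs hst
    omega
  · exact hst
  · have := filteredPos_lt ht hst
    omega

theorem entered_iff {α : Type*} {f : α → Option (Label P Unit Lap)} {G : List α} {l : Lap} :
    Entered (G.filterMap f) l ↔ EnteredAt (view f G) l := by
  constructor
  · rintro ⟨i, j, p, h⟩
    obtain ⟨i', j', -, -, h'⟩ := h.exists_completesAt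
    exact ⟨i', j', p, h'⟩
  · rintro ⟨i, j, p, h⟩
    exact ⟨_, _, p, h.completes⟩

/-- The order depends on the history, so each use fixes one finite execution and argues with its
order only. -/
theorem IsRacing.exists_isRacingOrder {R : Impl P Unit Lap} (hR : IsRacing R) {α : Type*}
    {f : α → Option (Label P Unit Lap)} {G : List α} {x : R.State}
    (h : R.Run (G.filterMap f) x) : ∃ lt, IsRacingOrder lt (view f G) := by
  obtain ⟨lt, hlt, hr⟩ := hR _ _ h
  refine ⟨lt, hlt, fun {i j p l} hc {i' j'} hc' => ?_, fun {i j p l} hc => ?_⟩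
  · exact filteredPos_inj hc'.2.1 hc.2.1 ((hr _ _ _ _ hc.completes).1 _ _ hc'.completes)
  · rcases (hr _ _ _ _ hc.completes).2 with ⟨i', j', q, k, h1, h2, h3, h4⟩ | h
    · obtain ⟨a, b, rfl, rfl, hab⟩ := h1.exists_completesAt
      obtain ⟨k, hk, rfl⟩ := exists_view_of_getElem?_filterMap h4
      exact Or.inl ⟨a, b, q, k, hab, lt_of_filteredPos_lt h2, lt_of_filteredPos_lt h3, hk⟩
    · right
      intro l' hl'
      obtain ⟨i', j', h1, h2, h3⟩ := h l' ⟨entered_iff.2 hl'.1, hl'.2.1,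
        fun l'' h => hl'.2.2 l'' (entered_iff.1 h)⟩
      obtain ⟨a, b, rfl, rfl, hab⟩ := h1.exists_completesAt
      exact ⟨a, b, hab, lt_of_filteredPos_lt h2, fun k hk hk' l'' hv =>
        h3 _ (filteredPos_lt hab.2.2.1 hk) (filteredPos_lt hv hk') l'' (getElem?_filteredPos hv)⟩

end RacingAt

/-! ### Decided laps, and the state from which a lap computes -/

section Linearization

variable {P Lap S Op Res : Type*} {τ : S → Op → S × Res} {s₀ : S}
  {G : List (Event P Lap S Op Res)} {X : ℕ → P → Loc Lap S Op Res}

/-- The consensus objects behave as such in `G`. -/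
def ConsLinearizable (G : List (Event P Lap S Op Res)) : Prop :=
  ∀ l, ∃ L, IsLinearization (consSpec P (S × P)) (G.filterMap (consEvent l)) L

/-- Some operation on the consensus object `l` returned `u` before time `t`. -/
def DecidedBefore (G : List (Event P Lap S Op Res)) (l : Lap) (t : ℕ) (u : S × P) : Prop :=
  ∃ i j p op, j < t ∧ CompletesAt (view (consEvent l) G) i j p op (some u)

theorem DecidedBefore.mono {l : Lap} {t t' : ℕ} {u : S × P} (h : DecidedBefore G l t u)
    (htt : t ≤ t') : DecidedBefore G l t' u := by
  obtain ⟨i, j, p, op, hj, hc⟩ := h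
  exact ⟨i, j, p, op, by omega, hc⟩

theorem DecidedBefore.agree (hC : ConsLinearizable G) {l : Lap} {t t' : ℕ} {u u' : S × P}
    (h : DecidedBefore G l t u) (h' : DecidedBefore G l t' u') : u = u' := by
  obtain ⟨i, j, p, op, -, hc⟩ := h
  obtain ⟨i', j', p', op', -, hc'⟩ := h'
  exact consensus_agreement (hC l) hc.completes hc'.completes

theorem DecidedBefore.valid (hC : ConsLinearizable G) {l : Lap} {t : ℕ} {u : S × P}
    (h : DecidedBefore G l t u) :
    ∃ k q, view (consEvent l) G k = some (Label.inv q (ConsOp.propose u)) := by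
  obtain ⟨i, j, p, op, -, hc⟩ := h
  obtain ⟨k, q, hk⟩ := consensus_validity (hC l) hc.completes
  obtain ⟨k, hk, -⟩ := exists_view_of_getElem?_filterMap hk
  exact ⟨k, q, hk⟩

/-- This is the main source of contradictions below: a read that returned `⊥` must have started
before the decision of its lap was first returned. -/
theorem DecidedBefore.not_read_none (hC : ConsLinearizable G) {l : Lap} {t i j : ℕ} {u : S × P}
    (h : DecidedBefore G l t u) {p : P} {op : ConsOp (S × P)}
    (hc : CompletesAt (view (consEvent l) G) i j p op none) : i < t := by
  obtain ⟨i', j', p', op', hj, hc'⟩ := h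
  by_contra hi
  exact consensus_read_after (hC l) hc'.completes hc.completes
    (filteredPos_lt hc'.2.2.1 (by omega))

namespace Trace

variable (T : Trace τ s₀ G X)
include T

theorem label_step {t : ℕ} {a : Label P Op Res} (h : (G.map Prod.fst)[t]? = some a) :
    ∃ e, G[t]? = some (a, e) ∧ LocalStep τ a.proc (X t a.proc) a e (X (t + 1) a.proc) := by
  rw [List.getElem?_map, Option.map_eq_some_iff] at h
  obtain ⟨⟨a, e⟩, hg, rfl⟩ := h
  exact ⟨e, hg, T.localStep hg⟩

/-- Whoever leaves a lap knows its decision. -/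
theorem decidedBefore_of_leave {i j k : ℕ} {p : P} {l : Lap}
    (hc : CompletesAt (view racEvent G) i j p () l) (hjk : j < k)
    (hk : view racEvent G k = some (Label.inv p ())) : ∃ u, DecidedBefore G l k u := by
  obtain ⟨c, s, op, -, h1⟩ := T.rac_response hc.2.2.1
  obtain ⟨c', s', op', h2, -⟩ := T.rac_invoke hk
  -- The visit to `l` can only end with a read that returns a decision.
  obtain ⟨m, a, e, hm, hmk, hq, hall, hg, hs⟩ := T.exists_exit p
    (fun x => x.cur = some l ∧ (∀ op, x.pc ≠ Pc.enter op) ∧ ∀ op, x.pc ≠ Pc.entering op)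
    (k := j + 1) (t := k) hjk (view_lt_length hk).le (by simp [h1]) (by simp [h2])
  have h3 := hall m hm le_rfl
  have : ∃ s op d, X m p = ⟨some l, s, Pc.reading op⟩ ∧
      view (consEvent l) G m = some (Label.step p (some (some d))) := by
    generalize hx : X m p = x at hs h3
    generalize hy : X (m + 1) p = y at hs hq
    cases hs <;> simp_all [view]
  obtain ⟨s, op, d, hx, hv⟩ := this
  obtain ⟨i', -, -, hc, -⟩ := T.completesAt_read hx hv
  exact ⟨d, i', m, p, _, hmk, hc⟩

theorem decidedBefore_of_leftBefore {l : Lap} {t : ℕ}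
    (h : LeftBeforeAt (view racEvent G) l t) : ∃ u, DecidedBefore G l t u := by
  obtain ⟨i, j, q, k, hc, hjk, hkt, hk⟩ := h
  obtain ⟨u, hu⟩ := T.decidedBefore_of_leave hc hjk hk
  exact ⟨u, hu.mono hkt.le⟩

omit T in
theorem finite_entered (G : List (Event P Lap S Op Res)) :
    {l | EnteredAt (view racEvent G) l}.Finite := by
  classical
  have : {l | EnteredAt (view racEvent G) l} ⊆ ⋃ j ∈ Set.Iio G.length,
      {l | ∃ p, view racEvent G j = some (Label.step p (some l))} := by
    rintro l ⟨i, j, p, hc⟩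
    simp only [Set.mem_iUnion]
    exact ⟨j, view_lt_length hc.2.2.1, p, hc.2.2.1⟩
  refine Set.Finite.subset ((Set.finite_Iio _).biUnion fun j _ => ?_) this
  refine Set.Subsingleton.finite ?_
  rintro l ⟨p, hp⟩ l' ⟨p', hp'⟩
  simp_all

omit T in
-- A finite history enters finitely many laps, so the entered ones below `l` have a greatest
-- element.
theorem exists_isPredLapAt {lt : Lap → Lap → Prop} (hlt : IsStrictTotalOrder Lap lt) {l₁ l : Lap}
    (h₁ : EnteredAt (view racEvent G) l₁) (h : lt l₁ l) :
    ∃ l', IsPredLapAt lt (view racEvent G) l' l := by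
  classical
  let _ := linearOrderOfSTO lt
  have hfin : {l' | EnteredAt (view racEvent G) l' ∧ lt l' l}.Finite :=
    (finite_entered G).subset fun _ h => h.1
  obtain ⟨l', ⟨h1, h2⟩, h3⟩ := hfin.exists_maximalFor id _ ⟨l₁, h₁, h⟩
  refine ⟨l', h1, h2, fun l'' h4 ⟨h5, h6⟩ => ?_⟩
  have h7 : l'' ≤ l' := h3 ⟨h4, h6⟩ (le_of_lt h5)
  exact absurd h5 (not_lt.2 h7)

variable (hC : ConsLinearizable G) {lt : Lap → Lap → Prop}
  (hR : IsRacingOrder lt (view racEvent G))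

include hR in
/-- A lap is decided before any greater one is entered. -/
theorem decidedBefore_of_lt {l l' : Lap} (hl : EnteredAt (view racEvent G) l) (hll : lt l l')
    {i j : ℕ} {p : P} (hc : CompletesAt (view racEvent G) i j p () l') :
    ∃ u, DecidedBefore G l j u := by
  have := hR.sto
  induction j using Nat.strong_induction_on generalizing i p l' with
  | _ j ih =>
    -- Either some process left `l'`, and so entered it, at an earlier time, to which the induction
    -- applies; or `p` comes from the predecessor `l''` of `l'`. In the second case `l ≤ l''`: for
    -- `l < l''` the induction applies to the earlier entry into `l''`, and for `l = l''` leaving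
    -- `l` has revealed its decision.
    rcases hR.pred hc with ⟨i', j', q, k, hc', hjk, hkj, -⟩ | hpred
    · obtain ⟨u, hu⟩ := ih j' (by omega) hll hc'
      exact ⟨u, hu.mono (by omega)⟩
    · obtain ⟨l'', hl''⟩ := exists_isPredLapAt hR.sto hl hll
      obtain ⟨i', j', hc', hji, -⟩ := hpred l'' hl''
      have hij := hc.1
      rcases trichotomous_of lt l l'' with h | rfl | h
      · obtain ⟨u, hu⟩ := ih j' (by omega) h hc'
        exact ⟨u, hu.mono (by omega)⟩
      · obtain ⟨u, hu⟩ := T.decidedBefore_of_leave hc' hji hc.2.1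
        exact ⟨u, hu.mono hij.le⟩
      · exact absurd ⟨h, hll⟩ (hl''.2.2 l hl)

/-- The entry into the lap of a process that is about to compute, and its read of the decision
register. -/
theorem compute_visit {t : ℕ} (ht : t ≤ G.length) {p : P} {l : Lap} {s : S} {op : Op}
    (h : X t p = ⟨some l, s, Pc.compute op⟩) :
    ∃ i j c op' a b, CompletesAt (view racEvent G) i j p () l ∧ X i p = ⟨c, s, Pc.enter op'⟩ ∧
      j < a ∧ CompletesAt (view (consEvent l) G) a b p ConsOp.read none ∧ b < t ∧
      X a p = ⟨some l, s, Pc.test op⟩ ∧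
      ∀ m, a < m → m ≤ t →
        X m p = ⟨some l, s, Pc.reading op⟩ ∨ X m p = ⟨some l, s, Pc.compute op⟩ := by
  obtain ⟨a, b, hbt, hx, hc, hall⟩ := T.compute_start ht h
  have := hc.1
  obtain ⟨i, j, c, op', hj, hce, hi, -⟩ := T.visit_start (t := a) (by omega) (p := p) (l := l)
    (s := s) (by simp [hx]) (by simp [hx]) (by simp [hx]) (by simp [hx])
  exact ⟨i, j, c, op', a, b, hce, hi, hj, hc, hbt, hx, hall⟩

include hC hR in
/-- A process that computes at a lap has the decision of the preceding lap. -/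
theorem compute_state {t : ℕ} (ht : t ≤ G.length) {p : P} {l : Lap} {s : S} {op : Op}
    (h : X t p = ⟨some l, s, Pc.compute op⟩) :
    (∀ l', IsPredLapAt lt (view racEvent G) l' l → ∃ q, DecidedBefore G l' t (s, q)) ∧
      ((∀ l', EnteredAt (view racEvent G) l' → ¬ lt l' l) → s = s₀) := by
  have := hR.sto
  obtain ⟨i, j, c, op', a, b, hce, hi, hja, hc, hbt, -, -⟩ := T.compute_visit ht h
  have hij := hce.1
  have hab := hc.1
  have hile : i ≤ G.length := by omega
  -- If some process had left `l` before this entry, `l` would have been decided before the read,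
  -- which returned `⊥`.
  have hpred := (hR.pred hce).resolve_left fun hl => by
    obtain ⟨u, hu⟩ := T.decidedBefore_of_leftBefore hl
    have := hu.not_read_none hC hc
    omega
  rcases c with _ | l₀
  · refine ⟨fun l' hl' => ?_, fun _ => ?_⟩
    · obtain ⟨i', j', hc', hji, -⟩ := hpred l' hl'
      exact absurd (by simp [hi]) (T.rac_response_cur hile hji hc'.2.2.1)
    · have := (T.st_of_cur_none hile (p := p) (by simp [hi])).1
      simpa [hi] using this
  · obtain ⟨i₁, j₁, hc₁, hj₁, hlast₁⟩ := T.enter_justLeft hile hi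
    obtain ⟨i₂, j₂, q, hj₂, hc₂⟩ := T.enter_start hile hi
    refine ⟨fun l' hl' => ?_, fun hmin => ?_⟩
    · obtain ⟨i', j', hc', hji, hlast⟩ := hpred l' hl'
      -- Both are the time of the last entry of `p` before `i`, so the predecessor given by the
      -- racing is the lap whose decision `p` has read.
      have hjj : j' = j₁ := by
        rcases lt_trichotomy j' j₁ with h | h | h
        · exact absurd hc₁.2.2.1 (hlast j₁ h hj₁ l₀)
        · exact h
        · exact absurd hc'.2.2.1 (hlast₁ j' h hji l')
      have hv := hc'.2.2.1
      rw [hjj, hc₁.2.2.1] at hv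
      obtain rfl : l₀ = l' := by simpa using hv
      exact ⟨q, i₂, j₂, p, _, by omega, hc₂⟩
    · exfalso
      -- The lap `l₀` left by `p` is not below the least lap `l`, nor equal to it since laps are
      -- entered only once. If it were above, `l` would have been decided before `p` entered `l₀`,
      -- hence before the later read of `⊥` at `l`.
      rcases trichotomous_of lt l₀ l with h | rfl | h
      · exact hmin l₀ ⟨_, _, _, hc₁⟩ h
      · have := hR.new hc₁ hce
        have := hc₁.1
        omega
      · obtain ⟨u, hu⟩ := T.decidedBefore_of_lt hR ⟨_, _, _, hce⟩ h hc₁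
        have := hu.not_read_none hC hc
        omega

include hC in
/-- The return of a proposal of a process that does something else at time `t'`. -/
theorem propose_return {t t' : ℕ} {p : P} {l : Lap} {s : S} {op : Op} {v : Res}
    (h : X t p = ⟨some l, s, Pc.proposing op v⟩) (htt : t ≤ t') (ht' : t' ≤ G.length)
    (h' : X t' p ≠ ⟨some l, s, Pc.proposing op v⟩) :
    ∃ m u, t ≤ m ∧ m < t' ∧ X m p = ⟨some l, s, Pc.proposing op v⟩ ∧
      DecidedBefore G l (m + 1) u ∧ (u.2 = p → (X (m + 1) p).pc = Pc.idle) := by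
  obtain ⟨m, a, e, hm, hmk, hq, hall, hg, hs⟩ := T.exists_exit p
    (fun x => x = ⟨some l, s, Pc.proposing op v⟩) htt ht' h h'
  have h3 := hall m hm le_rfl
  have : ∃ d, view (consEvent l) G m = some (Label.step p (some d)) ∧
      (d.map Prod.snd = some p → (X (m + 1) p).pc = Pc.idle) := by
    generalize hx : X m p = x at hs h3
    generalize hy : X (m + 1) p = y at hs hq
    cases hs <;> simp_all [view]
  obtain ⟨d, hv, hd⟩ := this
  obtain ⟨i, -, -, -, hc, -⟩ := T.completesAt_propose h3 hv
  rcases d with _ | u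
  · exact absurd hc.completes (consensus_propose_ne_none (hC l))
  · exact ⟨m, u, hm, hmk, h3, ⟨i, m, p, _, by omega, hc⟩, fun hu => hd (by simp [hu])⟩

include hC in
/-- A process proposes at most once at a lap. -/
theorem propose_unique {t t' : ℕ} {p : P} {l : Lap} {u u' : S × P}
    (h : view (consEvent l) G t = some (Label.inv p (ConsOp.propose u)))
    (h' : view (consEvent l) G t' = some (Label.inv p (ConsOp.propose u'))) : t = t' := by
  wlog htt : t < t' generalizing t t' u u'
  · rcases lt_trichotomy t t' with h1 | h1 | h1
    · exact absurd h1 htt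
    · exact h1
    · exact (this h' h h1).symm
  exfalso
  obtain ⟨s, op, -, -, -, h1, -⟩ := T.propose_invoke h
  obtain ⟨s', op', h2, -⟩ := T.propose_invoke h'
  have hlen := (view_lt_length h').le
  obtain ⟨m, w, hm, hmt, hx, hd, -⟩ := T.propose_return hC h1 htt hlen (by simp [h2])
  obtain ⟨a, b, -, ha, hc, hall⟩ := T.compute_start hlen h2
  -- The first proposal returned at `m`, so the read before the second one started no later than
  -- `m`. But at time `m` the process is still proposing, so it can neither be about to read nor be
  -- past this read.
  have := hd.not_read_none hC hc
  rcases Nat.lt_or_ge a m with ham | ham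
  · rcases hall m ham hmt.le with h | h <;> simp [h] at hx
  · obtain rfl : a = m := by omega
    simp [ha] at hx

end Trace

end Linearization

/-! ## The linearization -/

section Commits

variable {P Lap S Op Res : Type*} {τ : S → Op → S × Res} {s₀ : S}
  {G : List (Event P Lap S Op Res)} {X : ℕ → P → Loc Lap S Op Res}

/-- At time `t`, the process of the operation `x` (invoked at `x.1`, with response `x.2.2.2`)
computes at lap `l` from the state `s`. -/
structure Commit (τ : S → Op → S × Res) (G : List (Event P Lap S Op Res))
    (X : ℕ → P → Loc Lap S Op Res) (t : ℕ) (l : Lap) (s : S) (x : ℕ × P × Op × Res) : Prop where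
  step : ∃ o, (G.map Prod.fst)[t]? = some (Label.step x.2.1 o)
  loc : X t x.2.1 = ⟨some l, s, Pc.compute x.2.2.1⟩
  res : x.2.2.2 = (τ s x.2.2.1).2
  lt : x.1 < t
  inv : (G.map Prod.fst)[x.1]? = some (Label.inv x.2.1 x.2.2.1)
  idle : (X x.1 x.2.1).pc = Pc.idle
  busy : ∀ m, x.1 < m → m ≤ t → (X m x.2.1).pc.op? = some x.2.2.1

/-- The operation `x`, computed at lap `l` from the state `s`, takes effect: it does not change the state, or its proposal is
decided. -/
def Effective (τ : S → Op → S × Res) (G : List (Event P Lap S Op Res)) (l : Lap) (s : S)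
    (x : ℕ × P × Op × Res) : Prop :=
  (τ s x.2.2.1).1 ≠ s → DecidedBefore G l G.length ((τ s x.2.2.1).1, x.2.1)

namespace Commit

theorem lt_length {t : ℕ} {l : Lap} {s : S} {x : ℕ × P × Op × Res} (c : Commit τ G X t l s x) :
    t < G.length := by
  obtain ⟨o, ho⟩ := c.step
  simpa using (List.getElem?_eq_some_iff.1 ho).1

/-- The process and the local state at time `t` determine everything except the invocation. Of two
candidate invocations, the later would find the process idle while the earlier operation is in
progress. -/
theorem unique {t : ℕ} {l l' : Lap} {s s' : S} {x x' : ℕ × P × Op × Res}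
    (c : Commit τ G X t l s x) (c' : Commit τ G X t l' s' x') : x = x' ∧ l = l' ∧ s = s' := by
  obtain ⟨i, p, op, r⟩ := x
  obtain ⟨i', p', op', r'⟩ := x'
  obtain ⟨o, ho⟩ := c.step
  obtain ⟨o', ho'⟩ := c'.step
  obtain rfl : p = p' := by
    rw [ho] at ho'
    simp at ho'
    exact ho'.1
  have hl := c.loc
  rw [c'.loc] at hl
  simp only [Loc.mk.injEq, Option.some.injEq, Pc.compute.injEq] at hl
  obtain ⟨rfl, rfl, rfl⟩ := hl
  obtain rfl : r = r' := c.res.trans c'.res.symm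
  refine ⟨?_, rfl, rfl⟩
  have h1 := c.busy i'
  have h2 := c'.busy i
  have h3 := c.idle
  have h4 := c'.idle
  have h5 := c.lt
  have h6 := c'.lt
  simp only at h1 h2 h3 h4 h5 h6
  rw [h4] at h1
  rw [h3] at h2
  simp only [Pc.op?, reduceCtorEq, imp_false] at h1 h2
  obtain rfl : i = i' := by omega
  rfl

end Commit

namespace Trace

variable (T : Trace τ s₀ G X)
include T

theorem exists_commit {t : ℕ} {p : P} {l : Lap} {s : S} {op : Op} {o : Option Res}
    (h : X t p = ⟨some l, s, Pc.compute op⟩)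
    (ht : (G.map Prod.fst)[t]? = some (Label.step p o)) :
    ∃ i, Commit τ G X t l s (i, p, op, (τ s op).2) := by
  have hlt : t < G.length := by simpa using (List.getElem?_eq_some_iff.1 ht).1
  obtain ⟨i, hi, hinv, hidle, hall⟩ := T.op_start (t := t) (p := p) (op := op) hlt.le
    (by simp [h, Pc.op?])
  exact ⟨i, ⟨o, ht⟩, h, rfl, hi, hinv, hidle, hall⟩

theorem invoke_idle {t : ℕ} {p : P} {op : Op}
    (h : (G.map Prod.fst)[t]? = some (Label.inv p op)) :
    (X t p).pc = Pc.idle ∧ (X (t + 1) p).pc.op? = some op := by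
  obtain ⟨e, -, hs⟩ := T.label_step h
  simp only [Label.proc] at hs
  generalize X t p = x at hs
  generalize X (t + 1) p = y at hs
  cases hs
  case inv c s => rcases c with _ | c <;> simp [Pc.op?]

theorem response_idle {t : ℕ} {p : P} {r : Res}
    (h : (G.map Prod.fst)[t]? = some (Label.step p (some r))) :
    (X t p).pc ≠ Pc.idle ∧ (X (t + 1) p).pc = Pc.idle := by
  obtain ⟨e, -, hs⟩ := T.label_step h
  simp only [Label.proc] at hs
  generalize X t p = x at hs
  generalize X (t + 1) p = y at hs
  cases hs <;> simp

/-- Without a response, an operation stays in progress. -/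
theorem busy_of_no_response {i t : ℕ} (hit : i < t) (ht : t ≤ G.length) {p : P} {op : Op}
    (h : (G.map Prod.fst)[i]? = some (Label.inv p op))
    (hr : ∀ k, i < k → k < t → ∀ r, (G.map Prod.fst)[k]? ≠ some (Label.step p (some r))) :
    (X t p).pc.op? = some op := by
  by_contra hn
  obtain ⟨m, a, e, hm, hmt, hq, hall, hg, hs⟩ := T.exists_exit p
    (fun x => x.pc.op? = some op) (k := i + 1) hit ht (T.invoke_idle h).2 hn
  have h1 := hall m hm le_rfl
  have h2 := hr m (by omega) hmt
  rw [List.getElem?_map, hg] at h2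
  generalize X m p = x at hs h1
  generalize X (m + 1) p = y at hs hq
  cases hs <;> simp_all [Pc.op?]

variable {t t' : ℕ} {l l' : Lap} {s s' : S} {x x' : ℕ × P × Op × Res}

theorem ret_of_commit (c : Commit τ G X t l s x) (h : (τ s x.2.2.1).1 = s) :
    (G.map Prod.fst)[t]? = some (Label.step x.2.1 (some x.2.2.2)) ∧
      (X (t + 1) x.2.1).pc = Pc.idle := by
  obtain ⟨o, ho⟩ := c.step
  obtain ⟨e, hg, hs⟩ := T.label_step ho
  simp only [Label.proc] at hs
  rw [ho, c.res]
  have hl := c.loc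
  generalize X t x.2.1 = z at hs hl
  generalize X (t + 1) x.2.1 = y at hs
  subst hl
  cases hs
  · simp
  · contradiction

theorem propose_of_commit (c : Commit τ G X t l s x) (h : (τ s x.2.2.1).1 ≠ s) :
    view (consEvent l) G t =
        some (Label.inv x.2.1 (ConsOp.propose ((τ s x.2.2.1).1, x.2.1))) ∧
      X (t + 1) x.2.1 = ⟨some l, s, Pc.proposing x.2.2.1 x.2.2.2⟩ := by
  obtain ⟨o, ho⟩ := c.step
  obtain ⟨e, hg, hs⟩ := T.label_step ho
  simp only [Label.proc] at hs
  rw [c.res]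
  have hl := c.loc
  generalize X t x.2.1 = z at hs hl
  generalize X (t + 1) x.2.1 = y at hs
  subst hl
  cases hs
  · contradiction
  · simp [view, hg]

/-- The operation is in progress up to its commit. Equality occurs when it does not change the
state, since such an operation returns in the step that commits it. -/
theorem le_response (c : Commit τ G X t l s x) {j : ℕ} {p : P} {op : Op} {r : Res}
    (h : Completes (G.map Prod.fst) x.1 j p op r) : p = x.2.1 ∧ op = x.2.2.1 ∧ t ≤ j := by
  obtain ⟨hij, hi, hj, -⟩ := h
  rw [c.inv] at hi
  simp only [Option.some.injEq, Label.inv.injEq] at hi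
  obtain ⟨rfl, rfl⟩ := hi
  refine ⟨rfl, rfl, ?_⟩
  by_contra hlt
  have := c.busy (j + 1) (by omega) (by omega)
  simp [(T.response_idle hj).2, Pc.op?] at this

/-- The time of the read that precedes a commit. -/
theorem read_of_commit (c : Commit τ G X t l s x) :
    ∃ i j a b, CompletesAt (view racEvent G) i j x.2.1 () l ∧ j < a ∧ x.1 < a ∧
      CompletesAt (view (consEvent l) G) a b x.2.1 ConsOp.read none ∧ b < t := by
  obtain ⟨i, j, -, -, a, b, hce, -, hja, hc, hbt, hx, hall⟩ := T.compute_visit c.lt_length.le c.loc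
  refine ⟨i, j, a, b, hce, hja, ?_, hc, hbt⟩
  by_contra ha
  rcases Nat.lt_or_ge a x.1 with h | h
  · rcases hall x.1 h c.lt.le with h | h <;> simpa [h] using c.idle
  · obtain h : a = x.1 := by omega
    have := c.idle
    rw [← h, hx] at this
    simp at this

variable (hC : ConsLinearizable G)

include hC in
/-- After an effective commit, a process computes again only in a later operation. -/
theorem exists_idle_after (c : Commit τ G X t l s x) (he : Effective τ G l s x) (htt : t < t')
    (ht' : t' ≤ G.length) {c' : Option Lap} {s' : S} {op : Op}
    (h : X t' x.2.1 = ⟨c', s', Pc.compute op⟩ ∨ (X t' x.2.1).pc = Pc.idle) :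
    ∃ m, t < m ∧ m ≤ t' ∧ (X m x.2.1).pc = Pc.idle ∧
      ((τ s x.2.2.1).1 ≠ s → ∃ u, DecidedBefore G l m u) := by
  by_cases hτ : (τ s x.2.2.1).1 = s
  · exact ⟨t + 1, by omega, htt, (T.ret_of_commit c hτ).2, fun h => absurd hτ h⟩
  · obtain ⟨-, h1⟩ := T.propose_of_commit c hτ
    obtain ⟨m, u, hm, hmt, hx, hd, hu⟩ := T.propose_return hC h1 htt ht' (by
      rcases h with h | h
      · simp [h]
      · intro h'
        simp [h'] at h)
    obtain rfl : u = _ := hd.agree hC (he hτ)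
    exact ⟨m + 1, by omega, by omega, hu rfl, fun _ => ⟨_, hd⟩⟩

include hC in
-- The process is idle at some time between the two commits, whereas a single operation would be in
-- progress throughout.
theorem start_ne (c : Commit τ G X t l s x) (c' : Commit τ G X t' l' s' x')
    (he : Effective τ G l s x) (htt : t < t') : x.1 ≠ x'.1 := by
  intro hxx
  have h1 := c.inv
  rw [hxx, c'.inv] at h1
  simp only [Option.some.injEq, Label.inv.injEq] at h1
  obtain ⟨m, hm, hm', hidle, -⟩ := T.exists_idle_after hC c he htt c'.lt_length.le
    (Or.inl (by rw [← h1.1]; exact c'.loc))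
  have := c'.busy m (by have := c.lt; omega) hm'
  rw [h1.1, hidle] at this
  simp [Pc.op?] at this

include hC in
theorem start_ne' (c : Commit τ G X t l s x) (c' : Commit τ G X t' l' s' x')
    (he : Effective τ G l s x) (he' : Effective τ G l' s' x') (htt : t ≠ t') : x.1 ≠ x'.1 := by
  rcases lt_or_gt_of_ne htt with h | h
  · exact T.start_ne hC c c' he h
  · exact (T.start_ne hC c' c he' h).symm

include hC in
/-- The real-time order of operations that commit at laps in increasing order. -/
theorem realTime_of_lt {lt : Lap → Lap → Prop} (hR : IsRacingOrder lt (view racEvent G))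
    (c : Commit τ G X t l s x) (c' : Commit τ G X t' l' s' x') (hll : lt l l') :
    ¬ ∃ j p op r, Completes (G.map Prod.fst) x'.1 j p op r ∧ j < x.1 := by
  rintro ⟨j, p, op, r, hc, hj⟩
  have h1 := (T.le_response c' hc).2.2
  obtain ⟨i₁, j₁, a, b, he, -, ha, hab, -⟩ := T.read_of_commit c
  obtain ⟨i₂, j₂, a', b', he', hja', -, hab', hb'⟩ := T.read_of_commit c'
  obtain ⟨u, hu⟩ := T.decidedBefore_of_lt hR ⟨_, _, _, he⟩ hll he'
  have := hu.not_read_none hC hab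
  have := hab'.1
  omega

/-- The real-time order of operations that commit in this order. -/
theorem realTime_of_commit_lt (c : Commit τ G X t l s x) (c' : Commit τ G X t' l' s' x')
    (htt : t < t') :
    ¬ ∃ j p op r, Completes (G.map Prod.fst) x'.1 j p op r ∧ j < x.1 := by
  rintro ⟨j, p, op, r, hc, hj⟩
  have h1 := (T.le_response c' hc).2.2
  have := c.lt
  omega

include hC in
/-- A read-only operation at a lap does not start after the return of a winning proposal. -/
theorem realTime_of_win (c : Commit τ G X t l s x) (c' : Commit τ G X t' l s' x')
    (hτ : (τ s' x'.2.2.1).1 ≠ s') (he' : Effective τ G l s' x') :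
    ¬ ∃ j p op r, Completes (G.map Prod.fst) x'.1 j p op r ∧ j < x.1 := by
  rintro ⟨j, p, op, r, hc, hj⟩
  obtain ⟨rfl, rfl, h1⟩ := T.le_response c' hc
  have hjl : j + 1 ≤ G.length := by
    simpa using (List.getElem?_eq_some_iff.1 hc.2.2.1).1
  -- The named arguments are fillers: they only occur in the other alternative, and here the process
  -- is idle after its response.
  obtain ⟨m, hm, hmj, -, hd⟩ := T.exists_idle_after hC c' he' (t' := j + 1) (by omega) hjl
    (c' := none) (s' := s) (op := x.2.2.1) (Or.inr (T.response_idle hc.2.2.1).2)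
  obtain ⟨u, hu⟩ := hd hτ
  obtain ⟨-, -, a, b, -, -, ha, hab, -⟩ := T.read_of_commit c
  have := hu.not_read_none hC hab
  omega

include hC in
/-- Every complete operation commits, and its commit is effective. -/
theorem commit_of_completes {i j : ℕ} {p : P} {op : Op} {r : Res}
    (h : Completes (G.map Prod.fst) i j p op r) :
    ∃ t l s, Commit τ G X t l s (i, p, op, r) ∧ Effective τ G l s (i, p, op, r) := by
  obtain ⟨hij, hi, hj, hk⟩ := h
  have hjl : j < G.length := by
    simpa using (List.getElem?_eq_some_iff.1 hj).1
  have hbusy : ∀ m, i < m → m ≤ j → (X m p).pc.op? = some op := fun m h1 h2 =>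
    T.busy_of_no_response h1 (by omega) hi fun k h3 h4 => hk k h3 (by omega)
  have hopj := hbusy j hij le_rfl
  obtain ⟨e, hg, hs⟩ := T.label_step hj
  simp only [Label.proc] at hs
  have : (∃ l s, X j p = ⟨some l, s, Pc.compute op⟩ ∧ (τ s op).1 = s ∧ r = (τ s op).2) ∨
      ∃ l s d, X j p = ⟨some l, s, Pc.proposing op r⟩ ∧ d.map Prod.snd = some p ∧
        view (consEvent l) G j = some (Label.step p (some d)) := by
    generalize hx : X j p = x at hs hopj
    generalize X (j + 1) p = y at hs
    cases hs <;> simp_all [Pc.op?, view]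
  rcases this with ⟨l, s, hx, hτ, rfl⟩ | ⟨l, s, d, hx, hd, hv⟩
  · exact ⟨j, l, s, ⟨⟨_, hj⟩, hx, rfl, hij, hi, (T.invoke_idle hi).1, hbusy⟩,
      fun h => absurd hτ h⟩
  · obtain ⟨t, htj, hxt, rfl, hc, hall⟩ := T.completesAt_propose hx hv
    obtain ⟨s', op', h1, hτ, -, -, hstep⟩ := T.propose_invoke hc.2.1
    rw [hxt] at h1
    simp only [Loc.mk.injEq, Pc.compute.injEq, true_and] at h1
    obtain ⟨rfl, rfl⟩ := h1
    have hit : i < t := by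
      by_contra hit
      have h2 := (T.invoke_idle hi).1
      rcases Nat.lt_or_ge t i with h3 | h3
      · simp [hall i h3 hij.le] at h2
      · obtain rfl : i = t := by omega
        simp [hxt] at h2
    refine ⟨t, l, s, ⟨⟨_, hstep⟩, hxt, rfl, hit, hi, (T.invoke_idle hi).1,
      fun m h1 h2 => hbusy m h1 (by omega)⟩, fun _ => ?_⟩
    rcases d with _ | u
    · simp at hd
    have hdec : DecidedBefore G l G.length u := ⟨t, j, p, _, hjl, hc⟩
    -- The decision `u` was proposed by some `q`, and a proposal carries the identifier of its
    -- author, so `q = p`. Since `p` proposes only once at `l`, this is the proposal of the present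
    -- operation.
    obtain ⟨k, q, hkv⟩ := hdec.valid hC
    obtain ⟨s'', op'', -, -, rfl, -, -⟩ := T.propose_invoke hkv
    obtain rfl : q = p := by simpa using hd
    obtain rfl := T.propose_unique hC hkv hc.2.1
    have := hc.2.1
    rw [hkv] at this
    simp only [Option.some.injEq, Label.inv.injEq, ConsOp.propose.injEq] at this
    rwa [this.2] at hdec

include hC in
/-- A decision comes from an effective commit. -/
theorem commit_of_decided {u : S × P} (h : DecidedBefore G l t u) :
    ∃ t s x, Commit τ G X t l s x ∧ (τ s x.2.2.1).1 ≠ s ∧ u = ((τ s x.2.2.1).1, x.2.1) := by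
  obtain ⟨k, q, hk⟩ := h.valid hC
  obtain ⟨s, op, hx, hτ, rfl, -, hstep⟩ := T.propose_invoke hk
  obtain ⟨i, hi⟩ := T.exists_commit hx hstep
  exact ⟨k, s, _, hi, hτ, rfl⟩

end Trace

end Commits

/-! ### The order of the commits, and its legality -/

section Order

variable {P Lap S Op Res : Type*} {τ : S → Op → S × Res} {s₀ : S}
  {G : List (Event P Lap S Op Res)} {X : ℕ → P → Loc Lap S Op Res}

open Classical in
/-- The commits at lap `l` of operations that do not change the state. -/
noncomputable def readOnlyTimes (τ : S → Op → S × Res) (G : List (Event P Lap S Op Res))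
    (X : ℕ → P → Loc Lap S Op Res) (l : Lap) : List ℕ :=
  (List.range G.length).filter fun t => ∃ s x, Commit τ G X t l s x ∧ (τ s x.2.2.1).1 = s

open Classical in
/-- The commit at lap `l` of the operation that is decided. -/
noncomputable def winTimes (τ : S → Op → S × Res) (G : List (Event P Lap S Op Res))
    (X : ℕ → P → Loc Lap S Op Res) (l : Lap) : List ℕ :=
  (List.range G.length).filter fun t => ∃ s x, Commit τ G X t l s x ∧ (τ s x.2.2.1).1 ≠ s ∧
    Effective τ G l s x

open Classical in
/-- The operation that commits at time `t`. -/
noncomputable def commitEntry (τ : S → Op → S × Res) (G : List (Event P Lap S Op Res))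
    (X : ℕ → P → Loc Lap S Op Res) (t : ℕ) : Option (ℕ × P × Op × Res) :=
  if h : ∃ x l s, Commit τ G X t l s x then some h.choose else none

theorem commitEntry_eq_some {t : ℕ} {x : ℕ × P × Op × Res} :
    commitEntry τ G X t = some x ↔ ∃ l s, Commit τ G X t l s x := by
  unfold commitEntry
  split_ifs with h
  · obtain ⟨l, s, c⟩ := h.choose_spec
    constructor
    · intro hx
      obtain rfl := Option.some.inj hx
      exact ⟨l, s, c⟩
    · rintro ⟨l', s', c'⟩
      rw [(c.unique c').1]
  · simp only [false_iff]
    exact fun h' => h ⟨x, h'⟩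

theorem Commit.entry {t : ℕ} {l : Lap} {s : S} {x : ℕ × P × Op × Res}
    (c : Commit τ G X t l s x) : commitEntry τ G X t = some x :=
  commitEntry_eq_some.2 ⟨l, s, c⟩

theorem mem_readOnlyTimes {t : ℕ} {l : Lap} : t ∈ readOnlyTimes τ G X l ↔
    ∃ s x, Commit τ G X t l s x ∧ (τ s x.2.2.1).1 = s := by
  simp only [readOnlyTimes, List.mem_filter, List.mem_range, decide_eq_true_eq]
  exact ⟨fun h => h.2, fun h => ⟨by obtain ⟨s, x, c, -⟩ := h; exact c.lt_length, h⟩⟩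

theorem mem_winTimes {t : ℕ} {l : Lap} : t ∈ winTimes τ G X l ↔
    ∃ s x, Commit τ G X t l s x ∧ (τ s x.2.2.1).1 ≠ s ∧ Effective τ G l s x := by
  simp only [winTimes, List.mem_filter, List.mem_range, decide_eq_true_eq]
  exact ⟨fun h => h.2, fun h => ⟨by obtain ⟨s, x, c, -⟩ := h; exact c.lt_length, h⟩⟩

theorem mem_times {t : ℕ} {l : Lap} : t ∈ readOnlyTimes τ G X l ++ winTimes τ G X l ↔
    ∃ s x, Commit τ G X t l s x ∧ Effective τ G l s x := by
  rw [List.mem_append, mem_readOnlyTimes, mem_winTimes]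
  constructor
  · rintro (⟨s, x, c, h⟩ | ⟨s, x, c, h, he⟩)
    · exact ⟨s, x, c, fun h' => absurd h h'⟩
    · exact ⟨s, x, c, he⟩
  · rintro ⟨s, x, c, he⟩
    by_cases h : (τ s x.2.2.1).1 = s
    · exact Or.inl ⟨s, x, c, h⟩
    · exact Or.inr ⟨s, x, c, h, he⟩

/-- The laps in increasing order, each one with its operations. -/
noncomputable def commitOrder (τ : S → Op → S × Res) (G : List (Event P Lap S Op Res))
    (X : ℕ → P → Loc Lap S Op Res) (laps : List Lap) : List (ℕ × P × Op × Res) :=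
  (laps.flatMap fun l => readOnlyTimes τ G X l ++ winTimes τ G X l).filterMap (commitEntry τ G X)

theorem exists_sorted {α : Type*} {lt : α → α → Prop} (hlt : IsStrictTotalOrder α lt)
    {A : Set α} (hA : A.Finite) : ∃ L : List α, L.Pairwise lt ∧ ∀ a, a ∈ L ↔ a ∈ A := by
  classical
  let _ := linearOrderOfSTO lt
  refine ⟨hA.toFinset.sort (· ≤ ·), ?_, by simp⟩
  exact hA.toFinset.sortedLT_sort.pairwise

/-- The operations all start from `s` and leave it unchanged, so their order is irrelevant for
legality. -/
theorem Replays.readOnly {s : S} {w : List (P × Op × Res)} (hw : Replays τ s w) {ts : List ℕ}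
    (h : ∀ t ∈ ts, ∃ l x, Commit τ G X t l s x ∧ (τ s x.2.2.1).1 = s) :
    Replays τ s ((ts.filterMap (commitEntry τ G X)).map Prod.snd ++ w) := by
  induction ts with
  | nil => exact hw
  | cons t ts ih =>
    obtain ⟨l, ⟨i, p, op, r⟩, c, hτ⟩ := h t (by simp)
    rw [List.filterMap_cons_some c.entry]
    refine ⟨c.res.symm, ?_⟩
    rw [show (τ s op).1 = s from hτ]
    exact ih fun t ht => h t (List.mem_cons_of_mem _ ht)

namespace Trace

variable (T : Trace τ s₀ G X) (hC : ConsLinearizable G)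
include T hC

/-- By agreement both winners proposed the same pair, so they have the same process, which proposes
only once at `l`. -/
theorem winTimes_eq {t t' : ℕ} {l : Lap} (h : t ∈ winTimes τ G X l) (h' : t' ∈ winTimes τ G X l) :
    t = t' := by
  obtain ⟨s, x, c, hτ, he⟩ := mem_winTimes.1 h
  obtain ⟨s', x', c', hτ', he'⟩ := mem_winTimes.1 h'
  have h1 := (he hτ).agree hC (he' hτ')
  simp only [Prod.mk.injEq] at h1
  have h2 := (T.propose_of_commit c hτ).1
  have h3 := (T.propose_of_commit c' hτ').1
  rw [← h1.2] at h3
  exact T.propose_unique hC h2 h3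

theorem winTimes_eq_nil_or (l : Lap) :
    winTimes τ G X l = [] ∨ ∃ t, winTimes τ G X l = [t] := by
  have hn : (winTimes τ G X l).Nodup := List.nodup_range.filter _
  rcases h : winTimes τ G X l with _ | ⟨t, _ | ⟨t', w⟩⟩
  · exact Or.inl rfl
  · exact Or.inr ⟨t, rfl⟩
  · have := T.winTimes_eq hC (l := l) (t := t) (t' := t') (by simp [h]) (by simp [h])
    rw [h] at hn
    simp [this] at hn

variable {lt : Lap → Lap → Prop} (hR : IsRacingOrder lt (view racEvent G))
include hR

/-- Three cases: two operations of a lap that leave the state unchanged are ordered by commit times,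
which lie between invocation and response; such an operation precedes the winner because it reads
`⊥`; and different laps are compared by `realTime_of_lt`. Distinct invocations make the entries of
the linearization distinct. -/
theorem pairwise_commitOrder {laps : List Lap}
    (hs : laps.Pairwise lt) :
    (commitOrder τ G X laps).Pairwise fun x y => x.1 ≠ y.1 ∧
      ¬ ∃ j p op r, Completes (G.map Prod.fst) y.1 j p op r ∧ j < x.1 := by
  have := hR.sto
  refine List.pairwise_filterMap.2 (List.pairwise_flatMap.2 ⟨fun l _ => ?_, hs.imp ?_⟩)
  · refine List.pairwise_append.2 ⟨?_, ?_, ?_⟩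
    · refine (List.pairwise_lt_range.filter _).imp_of_mem fun {t t'} ht ht' htt x hx x' hx' => ?_
      obtain ⟨s, y, c, hτ⟩ := mem_readOnlyTimes.1 ht
      obtain ⟨s', y', c', hτ'⟩ := mem_readOnlyTimes.1 ht'
      obtain rfl : x = y := by rw [c.entry] at hx; exact (Option.some.inj hx).symm
      obtain rfl : x' = y' := by rw [c'.entry] at hx'; exact (Option.some.inj hx').symm
      exact ⟨T.start_ne hC c c' (fun h => absurd hτ h) htt, T.realTime_of_commit_lt c c' htt⟩
    · rcases T.winTimes_eq_nil_or hC l with h | ⟨t, h⟩ <;> simp [h]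
    · intro t ht t' ht' x hx x' hx'
      obtain ⟨s, y, c, hτ⟩ := mem_readOnlyTimes.1 ht
      obtain ⟨s', y', c', hτ', he'⟩ := mem_winTimes.1 ht'
      obtain rfl : x = y := by rw [c.entry] at hx; exact (Option.some.inj hx).symm
      obtain rfl : x' = y' := by rw [c'.entry] at hx'; exact (Option.some.inj hx').symm
      refine ⟨T.start_ne' hC c c' (fun h => absurd hτ h) he' ?_,
        T.realTime_of_win hC c c' hτ' he'⟩
      rintro rfl
      obtain ⟨rfl, -, rfl⟩ := c.unique c'
      exact hτ' hτ
  · intro l l' hll t ht t' ht' x hx x' hx'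
    obtain ⟨s, y, c, he⟩ := mem_times.1 ht
    obtain ⟨s', y', c', he'⟩ := mem_times.1 ht'
    obtain rfl : x = y := by rw [c.entry] at hx; exact (Option.some.inj hx).symm
    obtain rfl : x' = y' := by rw [c'.entry] at hx'; exact (Option.some.inj hx').symm
    refine ⟨T.start_ne' hC c c' he he' ?_, T.realTime_of_lt hC hR c c' hll⟩
    rintro rfl
    obtain ⟨-, rfl, -⟩ := c.unique c'
    exact irrefl_of lt l hll

/-- The state is passed from lap to lap: by `compute_state`, every computation at the next lap
starts from the decision of the present one, which is what its winner wrote. -/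
theorem replays_commitOrder {laps : List Lap} (hs : laps.Pairwise lt)
    (hmem : ∀ l, l ∈ laps ↔ EnteredAt (view racEvent G) l) :
    Replays τ s₀ ((commitOrder τ G X laps).map Prod.snd) := by
  have := hR.sto
  -- The induction is on the suffix `B` of laps still to be replayed, and `s` is the common starting
  -- state of the computations at its first lap. The prefix `A` is kept to recognize consecutive
  -- elements of the list as predecessor laps.
  suffices H : ∀ (B A : List Lap), laps = A ++ B → ∀ s,
      (∀ l ∈ B.head?, ∀ t s' x, Commit τ G X t l s' x → s' = s) →
      Replays τ s ((commitOrder τ G X B).map Prod.snd) by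
    refine H laps [] rfl s₀ fun l hl t s x c => (T.compute_state hC hR c.lt_length.le c.loc).2 ?_
    intro l' hl' hll
    rcases laps with _ | ⟨l₀, laps⟩
    · simp at hl
    · obtain rfl : l₀ = l := by simpa using hl
      rcases List.mem_cons.1 ((hmem l').2 hl') with rfl | h
      · exact irrefl_of lt _ hll
      · exact asymm_of lt hll (List.rel_of_pairwise_cons hs h)
  intro B
  induction B with
  | nil => intro A _ s _; simp [commitOrder, Replays]
  | cons l B ih =>
    intro A hA s hstate
    have hl : ∀ t s' x, Commit τ G X t l s' x → s' = s := hstate l (by simp)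
    have hle : EnteredAt (view racEvent G) l := (hmem l).1 (by simp [hA])
    have hnext : ∀ l' ∈ B.head?, IsPredLapAt lt (view racEvent G) l l' := by
      intro l' hl'
      obtain ⟨B, rfl⟩ : ∃ B', B = l' :: B' := by
        rcases B with _ | ⟨b, B⟩
        · simp at hl'
        · exact ⟨B, by simpa using hl'⟩
      rw [hA, List.pairwise_append, List.pairwise_cons, List.pairwise_cons] at hs
      refine ⟨hle, hs.2.1.1 l' (by simp), fun l'' hl'' ⟨h1, h2⟩ => ?_⟩
      have h3 := (hmem l'').2 hl''
      rw [hA, List.mem_append, List.mem_cons, List.mem_cons] at h3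
      rcases h3 with h3 | rfl | rfl | h3
      · exact asymm_of lt h1 (hs.2.2 l'' h3 l (by simp))
      · exact irrefl_of lt _ h1
      · exact irrefl_of lt _ h2
      · exact asymm_of lt h2 (hs.2.1.2.1 l'' h3)
    have hsplit : (commitOrder τ G X (l :: B)).map Prod.snd =
        ((readOnlyTimes τ G X l).filterMap (commitEntry τ G X)).map Prod.snd ++
          (((winTimes τ G X l).filterMap (commitEntry τ G X)).map Prod.snd ++
            (commitOrder τ G X B).map Prod.snd) := by
      simp [commitOrder]
    rw [hsplit]
    refine Replays.readOnly ?_ fun t ht => ?_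
    · have hih := ih (A ++ [l]) (by simp [hA])
      rcases T.winTimes_eq_nil_or hC l with h | ⟨t, h⟩
      -- Without a winner the lap was never decided, so nothing computes at the next lap, and the
      -- requirement on `s` is vacuous there.
      · rw [h]
        refine hih s fun l' hl' t s' x c => ?_
        exfalso
        obtain ⟨q, hd⟩ := (T.compute_state hC hR c.lt_length.le c.loc).1 l (hnext l' hl')
        obtain ⟨t', s'', y, c', hτ, he⟩ := T.commit_of_decided hC hd
        have : t' ∈ winTimes τ G X l :=
          mem_winTimes.2 ⟨s'', y, c', hτ, fun _ => he ▸ hd.mono c.lt_length.le⟩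
        simp [h] at this
      · have ht : t ∈ winTimes τ G X l := by simp [h]
        obtain ⟨s', ⟨i, p, op, r⟩, c, hτ, he⟩ := mem_winTimes.1 ht
        obtain rfl := hl _ _ _ c
        rw [h, List.filterMap_cons_some c.entry]
        refine ⟨c.res.symm, hih _ fun l' hl' t' s'' x c' => ?_⟩
        obtain ⟨q, hd⟩ := (T.compute_state hC hR c'.lt_length.le c'.loc).1 l (hnext l' hl')
        have := hd.agree hC (he hτ)
        simp only [Prod.mk.injEq] at this
        exact this.1
    · obtain ⟨s', x, c, hτ⟩ := mem_readOnlyTimes.1 ht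
      obtain rfl := hl _ _ _ c
      exact ⟨l, x, c, hτ⟩

theorem exists_linearization : ∃ L, IsLinearization (seqSpec P τ s₀) (G.map Prod.fst) L := by
  obtain ⟨laps, hs, hmem⟩ := exists_sorted hR.sto (finite_entered G)
  have hpw := T.pairwise_commitOrder hC hR hs
  refine ⟨commitOrder τ G X laps, List.pairwise_map.2 (hpw.imp fun h => h.1), fun x hx => ?_,
    fun i j p op r hc => ?_, hpw.imp fun h => h.2, T.replays_commitOrder hC hR hs hmem⟩
  · obtain ⟨t, -, ht⟩ := List.mem_filterMap.1 hx
    obtain ⟨l, s, c⟩ := commitEntry_eq_some.1 ht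
    exact c.inv
  · obtain ⟨t, l, s, c, he⟩ := T.commit_of_completes hC hc
    refine List.mem_filterMap.2 ⟨t, List.mem_flatMap.2 ⟨l, (hmem l).2 ?_, ?_⟩, c.entry⟩
    · obtain ⟨i, j, -, -, h, -⟩ := T.read_of_commit c
      exact ⟨i, j, p, h⟩
    · exact mem_times.2 ⟨s, _, c, he⟩

end Trace

theorem runiv_linearizable {R : Impl P Unit Lap}
    {C : Lap → Impl P (ConsOp (S × P)) (Option (S × P))} (hR : IsRacing R)
    (hC : ∀ l, (C l).Linearizable (consSpec P (S × P))) :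
    (runiv τ s₀ R C : Impl P Op Res).Linearizable (seqSpec P τ s₀) := by
  intro h σ hr
  obtain ⟨G, X, E, rfl⟩ := exists_exec hr
  obtain ⟨lt, hlt⟩ := hR.exists_isRacingOrder E.rac
  exact E.trace.exists_linearization (fun l => hC l _ _ (E.cons l)) hlt

end Order

/-! ## Obstruction-freedom -/

section WaitFree

variable {P Op Res : Type*}

theorem Impl.Run.exists_states {A : Impl P Op Res} {h : List (Label P Op Res)} {x : A.State}
    (hr : A.Run h x) : ∃ z : ℕ → A.State, z 0 = A.init ∧ z h.length = x ∧
      ∀ n a, h[n]? = some a → A.Next (h.take n) (z n) a (z (n + 1)) := by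
  induction hr with
  | nil => exact ⟨fun _ => A.init, rfl, rfl, by simp⟩
  | @snoc h x a x' _ hn ih =>
    obtain ⟨z, h0, h1, h2⟩ := ih
    refine ⟨fun n => if n ≤ h.length then z n else x', by simpa using h0, by simp, ?_⟩
    intro n b hb
    have hlt := (List.getElem?_eq_some_iff.1 hb).1
    rcases Nat.lt_or_ge n h.length with hl | hl
    · rw [List.getElem?_append_left hl] at hb
      simp only [hl.le, Nat.succ_le_of_lt hl, if_true]
      rw [List.take_append_of_le_length hl.le]
      exact h2 n b hb
    · obtain rfl : n = h.length := by simp at hlt; omega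
      obtain rfl : a = b := by simpa using hb
      simpa [h1] using hn

theorem Busy.append_replicate {h : List (Label P Op Res)} {p : P} (hb : Busy h p) (n : ℕ) :
    Busy (h ++ List.replicate n (Label.step p none)) p := by
  induction n with
  | zero => simpa using hb
  | succ n ih =>
    rw [List.replicate_succ', ← List.append_assoc, busy_append_singleton]
    exact Or.inr ⟨ih, by simp⟩

/-- A finite run followed by an endless solo run without response is an infinite execution in which
`p` takes infinitely many steps, against wait-freedom. -/
theorem Impl.WaitFree.obstructionFree {A : Impl P Op Res} (hA : A.WaitFree) :
    A.ObstructionFree := by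
  rintro h x p hr hb ⟨ρ, h0, hρ⟩
  obtain ⟨z, hz0, hz1, hz⟩ := hr.exists_states
  -- Past the end of `h`, the default value provides the silent steps of `p`.
  let a : ℕ → Label P Op Res := fun n => (h[n]?).getD (Label.step p none)
  let y : ℕ → A.State := fun n => if n < h.length then z n else ρ (n - h.length)
  have hyz : ∀ n, n ≤ h.length → y n = z n := by
    intro n hn
    rcases Nat.lt_or_ge n h.length with hl | hl
    · simp [y, hl]
    · obtain rfl : n = h.length := by omega
      simp [y, h0, hz1]
  have hyρ : ∀ n, y (h.length + n) = ρ n := fun n => by simp [y]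
  have hta : ∀ n, n ≤ h.length → (List.range n).map a = h.take n := by
    intro n hn
    apply List.ext_getElem?
    intro k
    rcases Nat.lt_or_ge k n with hk | hk
    · have hkl : k < h.length := by omega
      simp [a, hk, hkl]
    · simp [hk]
  have haf : ∀ n, (List.range (h.length + n)).map a =
      h ++ List.replicate n (Label.step p none) := by
    intro n
    induction n with
    | zero => simpa using hta h.length le_rfl
    | succ n ih =>
      rw [← Nat.add_assoc, List.range_succ, List.map_append, ih, List.replicate_succ',
        List.append_assoc]
      simp [a]
  obtain ⟨n, hn, r, hr'⟩ := hA y a ⟨by rw [hyz 0 (Nat.zero_le _), hz0], fun n => by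
      rcases Nat.lt_or_ge n h.length with hl | hl
      · rw [hta n hl.le, hyz n hl.le, hyz (n + 1) hl]
        exact hz n _ (by simp [a, hl])
      · obtain ⟨m, rfl⟩ := Nat.exists_eq_add_of_le hl
        rw [haf, hyρ, Nat.add_assoc, hyρ]
        have : a (h.length + m) = Label.step p none := by simp [a]
        rw [this]
        exact ⟨hb.append_replicate m, hρ m⟩⟩
    p (fun N => ⟨h.length + N, by omega, none, by simp [a]⟩) h.length
    (by simpa using haf 0 ▸ hb.append_replicate 0)
  simp [a, hn] at hr'

end WaitFree

/-! ### A process that runs alone -/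

section Solo

variable {P Lap S Op Res : Type*} {τ : S → Op → S × Res} {s₀ : S} {R : Impl P Unit Lap}
  {C : Lap → Impl P (ConsOp (S × P)) (Option (S × P))}

/-- After `n₀` events, the process `p` runs alone and does not respond. -/
structure SoloRun (τ : S → Op → S × Res) (s₀ : S) (p : P) (n₀ : ℕ)
    (G : ℕ → List (Event P Lap S Op Res)) (X : ℕ → P → Loc Lap S Op Res)
    (ρ : ℕ → UState R C Op Res) (e : ℕ → BaseEvent P Lap S) : Prop where
  exec : ∀ n, Exec τ s₀ (G n) X (ρ n)
  length : ∀ n, (G n).length = n₀ + n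
  loc : ∀ n, X (n₀ + n) = (ρ n).loc
  step : ∀ n, UStep τ (ρ n) (Label.step p none) (e n) (ρ (n + 1))
  get : ∀ n m, m < n → (G n)[n₀ + m]? = some (Label.step p none, e m)
  get_old : ∀ n t, t < n₀ → (G n)[t]? = (G 0)[t]?

theorem UStep.localStep {σ σ' : UState R C Op Res} {p : P} {o : Option Res}
    {e : BaseEvent P Lap S} (h : UStep τ σ (Label.step p o) e σ') :
    LocalStep τ p (σ.loc p) (Label.step p o) e (σ'.loc p) := by
  obtain ⟨q, hq, -⟩ := h.loc
  obtain rfl : p = q := hq.proc_eq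
  exact hq

/-- The prefixes of the infinite run share one function `X'` and one sequence of base events, so
that facts obtained at different lengths can be combined. -/
theorem exists_soloRun {G : List (Event P Lap S Op Res)} {X : ℕ → P → Loc Lap S Op Res}
    {ρ : ℕ → UState R C Op Res} (E : Exec τ s₀ G X (ρ 0)) {p : P}
    (hp : ((ρ 0).loc p).pc ≠ Pc.idle)
    (hρ : ∀ n, (ρ (n + 1), none) ∈ (runiv τ s₀ R C : Impl P Op Res).step p (ρ n)) :
    ∃ G' X' e, SoloRun τ s₀ p G.length G' X' ρ e ∧ G' 0 = G := by
  -- These executions are unrelated for different `n`. They only show that each state is well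
  -- formed, which yields the base events; the coherent executions are rebuilt from these
  -- afterwards.
  have hex : ∀ n, ((ρ n).loc p).pc ≠ Pc.idle ∧ ∃ G X, Exec τ s₀ G X (ρ n) := by
    intro n
    induction n with
    | zero => exact ⟨hp, G, X, E⟩
    | succ n ih =>
      obtain ⟨h1, G, X, E⟩ := ih
      obtain ⟨e, he⟩ := exists_uStep h1 (E.wellFormed p) (hρ n)
      obtain ⟨X', E'⟩ := E.exists_snoc he
      refine ⟨?_, _, X', E'⟩
      have hs := he.localStep
      generalize (ρ n).loc p = x at hs
      generalize (ρ (n + 1)).loc p = y at hs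
      cases hs <;> simp
  have hst : ∀ n, ∃ e, UStep τ (ρ n) (Label.step p none) e (ρ (n + 1)) := by
    intro n
    obtain ⟨h1, G, X, E⟩ := hex n
    exact exists_uStep h1 (E.wellFormed p) (hρ n)
  choose e he using hst
  let G' : ℕ → List (Event P Lap S Op Res) :=
    fun n => G ++ (List.range n).map fun m => (Label.step p none, e m)
  let X' : ℕ → P → Loc Lap S Op Res :=
    fun t => if t < G.length then X t else (ρ (t - G.length)).loc
  have hlen : ∀ n, (G' n).length = G.length + n := fun n => by simp [G']
  have hloc : ∀ n, X' (G.length + n) = (ρ n).loc := fun n => by simp [X']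
  have hX : ∀ t, t ≤ G.length → X' t = X t := by
    intro t ht
    rcases Nat.lt_or_ge t G.length with h | h
    · simp [X', h]
    · obtain rfl : t = G.length := by omega
      simp [X', E.loc]
  refine ⟨G', X', e, ⟨fun n => ?_, hlen, hloc, he, fun n m hm => ?_, fun n t ht => ?_⟩,
    by simp [G']⟩
  · induction n with
    | zero =>
      have : G' 0 = G := by simp [G']
      rw [this]
      refine { E with trace := ⟨?_, fun t g hg => ?_⟩, loc := by rw [hX _ le_rfl, E.loc] }
      · rw [hX 0 (Nat.zero_le _), E.trace.init]
      · have hlt := (List.getElem?_eq_some_iff.1 hg).1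
        rw [hX t hlt.le, hX (t + 1) hlt]
        exact E.trace.step t g hg
    | succ n ih =>
      have : G' (n + 1) = G' n ++ [(Label.step p none, e n)] := by
        simp [G', List.range_succ]
      rw [this]
      exact ih.snoc (he n) (fun _ _ => rfl) (by rw [hlen, Nat.add_assoc, hloc])
  · simp [G', hm]
  · simp [G', List.getElem?_append_left ht]

namespace SoloRun

variable {p : P} {n₀ : ℕ} {G : ℕ → List (Event P Lap S Op Res)} {X : ℕ → P → Loc Lap S Op Res}
  {ρ : ℕ → UState R C Op Res} {e : ℕ → BaseEvent P Lap S} (H : SoloRun τ s₀ p n₀ G X ρ e)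
include H

theorem localStep (n : ℕ) :
    LocalStep τ p ((ρ n).loc p) (Label.step p none) (e n) ((ρ (n + 1)).loc p) :=
  (H.step n).localStep

theorem view_cons {n m : ℕ} (hm : m < n) {l : Lap}
    {b : Label P (ConsOp (S × P)) (Option (S × P))} (h : e m = BaseEvent.cons l b) :
    view (consEvent l) (G n) (n₀ + m) = some b := by
  simp [view, H.get n m hm, h]

theorem view_rac {n m : ℕ} (hm : m < n) {b : Label P Unit Lap} (h : e m = BaseEvent.rac b) :
    view racEvent (G n) (n₀ + m) = some b := by
  simp [view, H.get n m hm, h]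

/-- `enter` responds. -/
theorem exists_entered (hR : R.ObstructionFree) {m : ℕ} {op : Op}
    (h : ((ρ m).loc p).pc = Pc.entering op) :
    ∃ m' ≥ m, ∃ l, e m' = BaseEvent.rac (Label.step p (some l)) := by
  by_contra hn
  push Not at hn
  have key : ∀ k, ((ρ (m + k)).loc p).pc = Pc.entering op ∧
      e (m + k) = BaseEvent.rac (Label.step p none) := by
    intro k
    have aux : ∀ k, ((ρ (m + k)).loc p).pc = Pc.entering op →
        e (m + k) = BaseEvent.rac (Label.step p none) ∧
          ((ρ (m + k + 1)).loc p).pc = Pc.entering op := by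
      intro k hk
      have hs := H.localStep (m + k)
      have hn := hn (m + k) (by omega)
      generalize (ρ (m + k)).loc p = x at hs hk
      generalize (ρ (m + k + 1)).loc p = y at hs
      generalize e (m + k) = b at hs hn ⊢
      cases hs <;> simp_all
    have hpc : ((ρ (m + k)).loc p).pc = Pc.entering op := by
      induction k with
      | zero => exact h
      | succ k ih => exact (aux k ih).2
    exact ⟨hpc, (aux k hpc).1⟩
  refine hR _ _ p (H.exec m).rac (((H.exec m).racBusy p).2 ⟨op, h⟩)
    ⟨fun k => (ρ (m + k)).rac, rfl, fun k => ?_⟩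
  exact (H.step (m + k)).rac _ (key k).2

/-- A read or a proposal responds. -/
theorem exists_response (hC : ∀ l, (C l).ObstructionFree) {m : ℕ} {l : Lap}
    (hc : ((ρ m).loc p).cur = some l)
    (h : (∃ op, ((ρ m).loc p).pc = Pc.reading op) ∨ ∃ op v, ((ρ m).loc p).pc = Pc.proposing op v) :
    ∃ m' ≥ m, (ρ m').loc p = (ρ m).loc p ∧
      ∃ d, e m' = BaseEvent.cons l (Label.step p (some d)) := by
  by_contra hn
  push Not at hn
  have key : ∀ k, (ρ (m + k)).loc p = (ρ m).loc p ∧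
      e (m + k) = BaseEvent.cons l (Label.step p none) := by
    intro k
    have aux : ∀ k, (ρ (m + k)).loc p = (ρ m).loc p →
        e (m + k) = BaseEvent.cons l (Label.step p none) ∧
          (ρ (m + k + 1)).loc p = (ρ m).loc p := by
      intro k hk
      have hs := H.localStep (m + k)
      have hn := hn (m + k) (by omega) hk
      rw [hk] at hs
      generalize (ρ m).loc p = x at hs hc h
      generalize (ρ (m + k + 1)).loc p = y at hs
      generalize e (m + k) = b at hs hn
      cases hs <;> simp_all
    have hpc : (ρ (m + k)).loc p = (ρ m).loc p := by
      induction k with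
      | zero => rfl
      | succ k ih => exact (aux k ih).2
    exact ⟨hpc, (aux k hpc).1⟩
  refine hC l _ _ p ((H.exec m).cons l) (((H.exec m).consBusy p l).2 ⟨hc, h⟩)
    ⟨fun k => (ρ (m + k)).cons l, rfl, fun k => ?_⟩
  exact (H.step (m + k)).cons l _ (key k).2

/-- After time `m`, the process `p` enters a lap or proposes. -/
def Progress (p : P) (e : ℕ → BaseEvent P Lap S) (m : ℕ) : Prop :=
  ∃ m' ≥ m, (∃ l, e m' = BaseEvent.rac (Label.step p (some l))) ∨
    ∃ l u, e m' = BaseEvent.cons l (Label.inv p (ConsOp.propose u))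

omit H in
theorem Progress.mono {m m' : ℕ} (h : Progress p e m') (hm : m ≤ m') : Progress p e m := by
  obtain ⟨k, hk, h⟩ := h
  exact ⟨k, hm.trans hk, h⟩

theorem progress_of_enter (hR : R.ObstructionFree) {m : ℕ} {c : Option Lap} {s : S} {op : Op}
    (h : (ρ m).loc p = ⟨c, s, Pc.enter op⟩) : Progress p e m := by
  have h1 : (ρ (m + 1)).loc p = ⟨c, s, Pc.entering op⟩ := by
    have hs := H.localStep m
    rw [h] at hs
    generalize (ρ (m + 1)).loc p = y at hs
    generalize e m = b at hs
    cases hs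
    rfl
  obtain ⟨m', hm', h'⟩ := H.exists_entered hR (m := m + 1) (op := op) (by rw [h1])
  exact ⟨m', by omega, Or.inl h'⟩

theorem progress_of_compute {m : ℕ} {l : Lap} {s : S} {op : Op}
    (h : (ρ m).loc p = ⟨some l, s, Pc.compute op⟩) : Progress p e m := by
  refine ⟨m, le_rfl, Or.inr ⟨l, ((τ s op).1, p), ?_⟩⟩
  have hs := H.localStep m
  rw [h] at hs
  generalize (ρ (m + 1)).loc p = y at hs
  generalize e m = b at hs ⊢
  cases hs
  rfl

theorem progress_of_reading (hR : R.ObstructionFree) (hC : ∀ l, (C l).ObstructionFree) {m : ℕ}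
    {l : Lap} {s : S} {op : Op} (h : (ρ m).loc p = ⟨some l, s, Pc.reading op⟩) :
    Progress p e m := by
  obtain ⟨m', hm', hx, d, hd⟩ := H.exists_response hC (m := m) (l := l) (by rw [h])
    (Or.inl ⟨op, by rw [h]⟩)
  have hs := H.localStep m'
  rw [hx, h, hd] at hs
  have : (ρ (m' + 1)).loc p = ⟨some l, s, Pc.compute op⟩ ∨
      ∃ s', (ρ (m' + 1)).loc p = ⟨some l, s', Pc.enter op⟩ := by
    generalize (ρ (m' + 1)).loc p = y at hs
    cases hs <;> simp
  rcases this with h | ⟨s', h⟩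
  · exact (H.progress_of_compute h).mono (by omega)
  · exact (H.progress_of_enter hR h).mono (by omega)

theorem progress_of_test (hR : R.ObstructionFree) (hC : ∀ l, (C l).ObstructionFree) {m : ℕ}
    {l : Lap} {s : S} {op : Op} (h : (ρ m).loc p = ⟨some l, s, Pc.test op⟩) :
    Progress p e m := by
  refine (H.progress_of_reading hR hC (m := m + 1) (l := l) (s := s) (op := op) ?_).mono
    (Nat.le_succ m)
  have hs := H.localStep m
  rw [h] at hs
  generalize (ρ (m + 1)).loc p = y at hs
  generalize e m = b at hs
  cases hs
  rfl

/-- A process that runs alone keeps entering laps and proposing. -/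
theorem progress (hR : R.ObstructionFree) (hC : ∀ l, (C l).ObstructionFree) (m : ℕ) :
    Progress p e m := by
  have hs := H.localStep m
  rcases hx : (ρ m).loc p with ⟨c, s, pc⟩
  rcases pc with _ | op | op | op | op | op | ⟨op, v⟩
  · rw [hx] at hs
    cases hs
  · exact H.progress_of_enter hR hx
  · obtain ⟨m', hm', h'⟩ := H.exists_entered hR (m := m) (op := op) (by rw [hx])
    exact ⟨m', hm', Or.inl h'⟩
  all_goals
    obtain ⟨l, rfl⟩ : ∃ l, c = some l := by
      rcases c with _ | l
      · simpa [hx] using (H.exec m).wellFormed p (by rw [hx])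
      · exact ⟨l, rfl⟩
  · exact H.progress_of_test hR hC hx
  · exact H.progress_of_reading hR hC hx
  · exact H.progress_of_compute hx
  · obtain ⟨m', hm', hx', d, hd⟩ := H.exists_response hC (m := m) (l := l) (by rw [hx])
      (Or.inr ⟨op, v, by rw [hx]⟩)
    have hs := H.localStep m'
    rw [hx', hx, hd] at hs
    refine (H.progress_of_test hR hC (m := m' + 1) (l := l) (s := s) (op := op) ?_).mono (by omega)
    generalize (ρ (m' + 1)).loc p = y at hs
    cases hs
    rfl

omit H in
theorem finite_proposed (G : List (Event P Lap S Op Res)) :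
    {l | ∃ k q u, view (consEvent l) G k = some (Label.inv q (ConsOp.propose u))}.Finite := by
  have : {l | ∃ k q u, view (consEvent l) G k = some (Label.inv q (ConsOp.propose u))} ⊆
      ⋃ k ∈ Set.Iio G.length,
        {l | ∃ q u, view (consEvent l) G k = some (Label.inv q (ConsOp.propose u))} := by
    rintro l ⟨k, q, u, h⟩
    simp only [Set.mem_iUnion]
    exact ⟨k, view_lt_length h, q, u, h⟩
  refine Set.Finite.subset ((Set.finite_Iio _).biUnion fun k _ => ?_) this
  refine Set.Subsingleton.finite ?_
  rintro l ⟨q, u, h⟩ l' ⟨q', u', h'⟩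
  obtain ⟨g, hg, h⟩ := view_eq_some.1 h
  obtain ⟨g', hg', h'⟩ := view_eq_some.1 h'
  obtain rfl : g = g' := by rw [hg] at hg'; exact Option.some.inj hg'
  rw [consEvent_eq_some] at h h'
  rw [h] at h'
  simp at h'
  exact h'.1

variable (hClin : ∀ l, (C l).Linearizable (consSpec P (S × P)))
include hClin

theorem consLinearizable (n : ℕ) : ConsLinearizable (G n) :=
  fun l => hClin l _ _ ((H.exec n).cons l)

/-- Where nobody had proposed before, all proposals come from the process that runs alone. -/
theorem decided_by {l : Lap}
    (hl : ∀ k q u, view (consEvent l) (G 0) k ≠ some (Label.inv q (ConsOp.propose u)))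
    {n t : ℕ} {u : S × P} (h : DecidedBefore (G n) l t u) :
    u.2 = p ∧ ∃ m, e m = BaseEvent.cons l (Label.inv p (ConsOp.propose u)) := by
  obtain ⟨k, q, hk⟩ := h.valid (H.consLinearizable hClin n)
  have hkl := view_lt_length hk
  rcases Nat.lt_or_ge k n₀ with hkn | hkn
  · exact absurd (by rwa [view, H.get_old n k hkn] at hk) (hl k q u)
  · obtain ⟨m, rfl⟩ := Nat.exists_eq_add_of_le hkn
    rw [H.length] at hkl
    obtain ⟨g, hg, hk'⟩ := view_eq_some.1 hk
    rw [H.get n m (by omega)] at hg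
    obtain rfl := Option.some.inj hg
    rw [consEvent_eq_some] at hk'
    obtain ⟨s, op, -, -, rfl, -⟩ := (H.exec n).trace.propose_invoke hk
    have hs := H.localStep m
    simp only at hk'
    rw [hk'] at hs
    obtain rfl : q = p := hs.cons_proc
    exact ⟨rfl, m, hk'⟩

/-- At a lap without earlier proposals every decision names `p` itself, so a proposal there would
return as a winner and end the operation. -/
theorem not_propose (hC : ∀ l, (C l).ObstructionFree) {l : Lap}
    (hl : ∀ k q u, view (consEvent l) (G 0) k ≠ some (Label.inv q (ConsOp.propose u)))
    (m : ℕ) (u : S × P) : e m ≠ BaseEvent.cons l (Label.inv p (ConsOp.propose u)) := by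
  intro hm
  have hv := H.view_cons (Nat.lt_succ_self m) hm
  obtain ⟨s, op, -, -, -, h1, -⟩ := (H.exec _).trace.propose_invoke hv
  rw [Nat.add_assoc, H.loc] at h1
  obtain ⟨m', hm', hx, d, hd⟩ := H.exists_response hC (m := m + 1) (l := l) (by simp [h1])
    (Or.inr ⟨_, _, by rw [h1]⟩)
  rw [h1] at hx
  have hs := H.localStep m'
  rw [hx, hd] at hs
  have hv' := H.view_cons (Nat.lt_succ_self m') hd
  have hx' := (congrFun (H.loc m') p).trans hx
  obtain ⟨i, -, -, -, hc, -⟩ := (H.exec (m' + 1)).trace.completesAt_propose hx' hv'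
  rcases d with _ | u
  · exact consensus_propose_ne_none (H.consLinearizable hClin _ l) hc.completes
  · have hu := (H.decided_by hClin hl ⟨i, _, p, _, Nat.lt_succ_self _, hc⟩).1
    generalize (ρ (m' + 1)).loc p = y at hs
    cases hs
    simp_all

/-- If `p` entered only laps of the finite set `A` of laps with earlier proposals, it would make
progress only finitely often, because it enters each lap and proposes at each lap at most once. So
it enters a lap outside `A`. There a read of `⊥` leads to a proposal, and a decision stems from a
proposal of `p`; `not_propose` excludes both. -/
theorem false_of_racing (hR : IsRacing R) (hRof : R.ObstructionFree)
    (hC : ∀ l, (C l).ObstructionFree) : False := by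
  have hnew : ∀ l, {m | e m = BaseEvent.rac (Label.step p (some l))}.Finite := by
    intro l
    refine Set.Subsingleton.finite ?_
    intro m hm m' hm'
    wlog hmm : m < m' generalizing m m'
    · rcases lt_trichotomy m m' with h | h | h
      · exact absurd h hmm
      · exact h
      · exact (this hm' hm h).symm
    exfalso
    have hv := H.view_rac (n := m' + 1) (by omega) hm
    have hv' := H.view_rac (n := m' + 1) (by omega) hm'
    have T := (H.exec (m' + 1)).trace
    obtain ⟨lt, hlt⟩ := hR.exists_isRacingOrder (H.exec (m' + 1)).rac
    obtain ⟨c, s, op, hx, -⟩ := T.rac_response hv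
    obtain ⟨c', s', op', hx', -⟩ := T.rac_response hv'
    obtain ⟨i, -, -, hc⟩ := T.completesAt_enter hx hv
    obtain ⟨i', -, -, hc'⟩ := T.completesAt_enter hx' hv'
    -- The two entries would have the same invocation, but the first response lies strictly between
    -- that invocation and the second response.
    obtain rfl := hlt.new hc hc'
    exact hc'.2.2.2 _ hc.1 (by omega) _ hv
  have honce : ∀ l, {m | ∃ u, e m = BaseEvent.cons l (Label.inv p (ConsOp.propose u))}.Finite := by
    intro l
    refine Set.Subsingleton.finite ?_
    rintro m ⟨u, hm⟩ m' ⟨u', hm'⟩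
    -- Any prefix that contains both events would do.
    have hv := H.view_cons (n := m + m' + 1) (by omega) hm
    have hv' := H.view_cons (n := m + m' + 1) (by omega) hm'
    have := (H.exec _).trace.propose_unique (H.consLinearizable hClin _) hv hv'
    omega
  have hfin := finite_proposed (G 0)
  set A := {l | ∃ k q u, view (consEvent l) (G 0) k = some (Label.inv q (ConsOp.propose u))}
  obtain ⟨m, l, hm, hl⟩ : ∃ m l, e m = BaseEvent.rac (Label.step p (some l)) ∧ l ∉ A := by
    by_contra hn
    push Not at hn
    have hfin' : (⋃ l ∈ A, ({m | e m = BaseEvent.rac (Label.step p (some l))} ∪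
        {m | ∃ u, e m = BaseEvent.cons l (Label.inv p (ConsOp.propose u))})).Finite :=
      hfin.biUnion fun l _ => (hnew l).union (honce l)
    obtain ⟨N, hN⟩ := hfin'.bddAbove
    obtain ⟨m, hm, h⟩ := H.progress hRof hC (N + 1)
    have : m ≤ N := by
      apply hN
      simp only [Set.mem_iUnion]
      rcases h with ⟨l, h⟩ | ⟨l, u, h⟩
      · exact ⟨l, hn m l h, Or.inl h⟩
      · refine ⟨l, ?_, Or.inr ⟨u, h⟩⟩
        by_contra hl
        exact H.not_propose hClin hC (l := l) (fun k q u h => hl ⟨k, q, u, h⟩) m u h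
    omega
  have hl' : ∀ k q u, view (consEvent l) (G 0) k ≠ some (Label.inv q (ConsOp.propose u)) :=
    fun k q u h => hl ⟨k, q, u, h⟩
  have hv := H.view_rac (Nat.lt_succ_self m) hm
  obtain ⟨c, s, op, -, h1⟩ := (H.exec _).trace.rac_response hv
  rw [Nat.add_assoc, H.loc] at h1
  have h2 : (ρ (m + 1 + 1)).loc p = ⟨some l, s, Pc.reading op⟩ := by
    have hs := H.localStep (m + 1)
    rw [h1] at hs
    generalize (ρ (m + 1 + 1)).loc p = y at hs
    generalize e (m + 1) = b at hs
    cases hs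
    rfl
  obtain ⟨m', hm', hx, d, hd⟩ := H.exists_response hC (m := m + 1 + 1) (l := l) (by simp [h2])
    (Or.inl ⟨op, by rw [h2]⟩)
  rw [h2] at hx
  have hs := H.localStep m'
  rw [hx, hd] at hs
  rcases d with _ | u
  · have h3 : (ρ (m' + 1)).loc p = ⟨some l, s, Pc.compute op⟩ := by
      generalize (ρ (m' + 1)).loc p = y at hs
      cases hs
      rfl
    -- Since `p` does not respond, its computation cannot return at once, so it proposes.
    have hs := H.localStep (m' + 1)
    rw [h3] at hs
    have := H.not_propose hClin hC hl' (m' + 1)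
    generalize (ρ (m' + 1 + 1)).loc p = y at hs
    generalize e (m' + 1) = b at hs this
    cases hs
    exact this _ rfl
  · have hv' := H.view_cons (Nat.lt_succ_self m') hd
    have hx' := (congrFun (H.loc m') p).trans hx
    obtain ⟨i, -, -, hc, -⟩ := (H.exec (m' + 1)).trace.completesAt_read hx' hv'
    obtain ⟨-, k, hk⟩ := H.decided_by hClin hl' ⟨i, _, p, _, Nat.lt_succ_self _, hc⟩
    exact H.not_propose hClin hC hl' k u hk

end SoloRun

theorem runiv_obstructionFree (hR : IsRacing R) (hRwf : R.WaitFree)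
    (hClin : ∀ l, (C l).Linearizable (consSpec P (S × P)))
    (hCof : ∀ l, (C l).ObstructionFree) :
    (runiv τ s₀ R C : Impl P Op Res).ObstructionFree := by
  rintro h σ p hr hb ⟨ρ, rfl, hρ⟩
  obtain ⟨G, X, E, rfl⟩ := exists_exec hr
  have hp := (E.busy p).1 hb
  obtain ⟨G', X', e, H, -⟩ := exists_soloRun E hp hρ
  exact H.false_of_racing hClin hR hRwf.obstructionFree hCof

end Solo

/-! ## The number of consensus objects -/

section Append

variable {P Lap S Op Res : Type*} {G : List (Event P Lap S Op Res)}

theorem view_append_left {α β : Type*} (f : α → Option β) (G : List α) (g : α) {t : ℕ}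
    (ht : t < G.length) : view f (G ++ [g]) t = view f G t := by
  simp [view, List.getElem?_append_left ht]

theorem view_append_length {α β : Type*} (f : α → Option β) (G : List α) (g : α) :
    view f (G ++ [g]) G.length = f g := by
  simp [view]

theorem CompletesAt.append {α P' Op' Res' : Type*} {f : α → Option (Label P' Op' Res')}
    {G : List α} {i j : ℕ} {p : P'} {op : Op'} {r : Res'}
    (h : CompletesAt (view f G) i j p op r) (g : α) :
    CompletesAt (view f (G ++ [g])) i j p op r := by
  obtain ⟨hij, hi, hj, hk⟩ := h
  have hjl := view_lt_length hj
  refine ⟨hij, ?_, ?_, fun k h1 h2 => ?_⟩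
  · rwa [view_append_left f G g (by omega)]
  · rwa [view_append_left f G g hjl]
  · rw [view_append_left f G g (by omega)]
    exact hk k h1 h2

theorem DecidedBefore.append {l : Lap} {t : ℕ} {u : S × P} (h : DecidedBefore G l t u)
    (g : Event P Lap S Op Res) : DecidedBefore (G ++ [g]) l t u := by
  obtain ⟨i, j, p, op, hj, hc⟩ := h
  exact ⟨i, j, p, op, hj, hc.append g⟩

/-- All proposals at lap `l` are equal to `u`. -/
def OnlyProposal (G : List (Event P Lap S Op Res)) (l : Lap) (u : S × P) : Prop :=
  ∀ t q u', view (consEvent l) G t = some (Label.inv q (ConsOp.propose u')) → u' = u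

/-- There is no proposal at lap `l`. -/
def NoProposal (G : List (Event P Lap S Op Res)) (l : Lap) : Prop :=
  ∀ t q u, view (consEvent l) G t ≠ some (Label.inv q (ConsOp.propose u))

theorem view_append_eq_some {α β : Type*} {f : α → Option β} {G : List α} {g : α} {t : ℕ} {b : β}
    (h : view f (G ++ [g]) t = some b) : view f G t = some b ∨ t = G.length ∧ f g = some b := by
  rcases Nat.lt_or_ge t G.length with ht | ht
  · left
    rwa [view_append_left f G g ht] at h
  · right
    have := view_lt_length h
    obtain rfl : t = G.length := by simp at this; omega
    rw [view_append_length] at h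
    exact ⟨rfl, h⟩

theorem NoProposal.append {l : Lap} (h : NoProposal G l) {g : Event P Lap S Op Res}
    (hg : ∀ q u, g.2 ≠ BaseEvent.cons l (Label.inv q (ConsOp.propose u))) :
    NoProposal (G ++ [g]) l := by
  intro t q u hv
  rcases view_append_eq_some hv with hv | ⟨-, hv⟩
  · exact h t q u hv
  · exact hg q u (consEvent_eq_some.1 hv)

theorem OnlyProposal.append {l : Lap} {u : S × P} (h : OnlyProposal G l u)
    {g : Event P Lap S Op Res}
    (hg : ∀ q u', g.2 = BaseEvent.cons l (Label.inv q (ConsOp.propose u')) → u' = u) :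
    OnlyProposal (G ++ [g]) l u := by
  intro t q u' hv
  rcases view_append_eq_some hv with hv | ⟨-, hv⟩
  · exact h t q u' hv
  · exact hg q u' (consEvent_eq_some.1 hv)

end Append

/-! ### A solo execution that decides ever more laps -/

section Unbounded

variable {P Lap S Op Res : Type*} {τ : S → Op → S × Res} {s₀ : S} {R : Impl P Unit Lap}
  {C : Lap → Impl P (ConsOp (S × P)) (Option (S × P))} {G : List (Event P Lap S Op Res)}
  {X : ℕ → P → Loc Lap S Op Res} {p : P} {s s' : S} {op : Op} {W : Finset Lap}

/-- The local states of `p`, the only process, in the course of the operation `op`, when the object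
moves from the state `s` to `s'`, and `W` are the laps decided before. -/
inductive SoloPhase (G : List (Event P Lap S Op Res)) (X : ℕ → P → Loc Lap S Op Res) (p : P)
    (s s' : S) (op : Op) (W : Finset Lap) : Loc Lap S Op Res → Prop
  | enter (c : Option Lap) : SoloPhase G X p s s' op W ⟨c, s, Pc.enter op⟩
  | entering (c : Option Lap) : SoloPhase G X p s s' op W ⟨c, s, Pc.entering op⟩
  -- The local copy `s₁` is arbitrary here: a winner does not update it, and the next operation
  -- recovers the state `s` from the decision register.
  | testOld (l : Lap) (s₁ : S) (h : DecidedBefore G l G.length (s, p)) :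
      SoloPhase G X p s s' op W ⟨some l, s₁, Pc.test op⟩
  | testNew (l : Lap) (h : NoProposal G l) : SoloPhase G X p s s' op W ⟨some l, s, Pc.test op⟩
  -- The time `t` records that the read was invoked when the lap had already been decided, so that
  -- it cannot return `⊥`.
  | readOld (l : Lap) (s₁ : S) (t : ℕ) (ht : t ≤ G.length) (h : DecidedBefore G l t (s, p))
      (hx : (X t p).pc = Pc.test op) : SoloPhase G X p s s' op W ⟨some l, s₁, Pc.reading op⟩
  | readNew (l : Lap) (h : NoProposal G l) : SoloPhase G X p s s' op W ⟨some l, s, Pc.reading op⟩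
  | compute (l : Lap) (h : NoProposal G l) : SoloPhase G X p s s' op W ⟨some l, s, Pc.compute op⟩
  | proposing (l : Lap) (v : Res) (hW : l ∉ W) (h : OnlyProposal G l (s', p)) :
      SoloPhase G X p s s' op W ⟨some l, s, Pc.proposing op v⟩

/-- With a single process, a lap that is newly entered has no proposal. The read there returns `⊥`,
and the proposal made there is the only one, so it wins. The lap won is outside `W`, since the laps
of `W` are decided and hence have proposals. -/
theorem SoloPhase.step {σ σ' : UState R C Op Res} {X' : ℕ → P → Loc Lap S Op Res}
    {o : Option Res} {e : BaseEvent P Lap S}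
    (hR : IsRacing R) (hC : ∀ l, (C l).Linearizable (consSpec P (S × P)))
    (E : Exec τ s₀ G X σ) (E' : Exec τ s₀ (G ++ [(Label.step p o, e)]) X' σ')
    (hX : ∀ t, t ≤ G.length → X' t = X t)
    (hs : LocalStep τ p (σ.loc p) (Label.step p o) e (σ'.loc p))
    (hp : ∀ l t q u, view (consEvent l) G t = some (Label.inv q (ConsOp.propose u)) → q = p)
    (hW : ∀ l ∈ W, ∃ u, DecidedBefore G l G.length u)
    (hτ : (τ s op).1 = s') (hss : s' ≠ s) (h : SoloPhase G X p s s' op W (σ.loc p)) :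
    (o = none ∧ SoloPhase (G ++ [(Label.step p o, e)]) X' p s s' op W (σ'.loc p)) ∨
      ∃ l, (σ'.loc p).cur = some l ∧ (σ'.loc p).pc = Pc.idle ∧ l ∉ W ∧
        DecidedBefore (G ++ [(Label.step p o, e)]) l (G.length + 1) (s', p) := by
  have hcl : ConsLinearizable G := fun l => hC l _ _ (E.cons l)
  have hcl' : ConsLinearizable (G ++ [(Label.step p o, e)]) := fun l => hC l _ _ (E'.cons l)
  have hnoW : ∀ l, NoProposal G l → l ∉ W := by
    intro l hl hlW
    obtain ⟨u, hu⟩ := hW l hlW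
    obtain ⟨k, q, hk⟩ := hu.valid hcl
    exact hl k q u hk
  have hlen : X' G.length p = σ.loc p := by rw [hX _ le_rfl, E.loc]
  have hread : ∀ l s₁ d, σ.loc p = ⟨some l, s₁, Pc.reading op⟩ →
      e = BaseEvent.cons l (Label.step p (some d)) →
      ∃ i < G.length, X' i p = ⟨some l, s₁, Pc.test op⟩ ∧
        CompletesAt (view (consEvent l) (G ++ [(Label.step p o, e)])) i G.length p ConsOp.read d ∧
        ∀ m, i < m → m ≤ G.length → X' m p = ⟨some l, s₁, Pc.reading op⟩ := by
    intro l s₁ d hl he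
    refine E'.trace.completesAt_read (hlen.trans hl) ?_
    rw [view_append_length, he, consEvent_cons_self]
  have hprop : ∀ l v d, σ.loc p = ⟨some l, s, Pc.proposing op v⟩ →
      e = BaseEvent.cons l (Label.step p (some d)) → OnlyProposal G l (s', p) → d = some (s', p) ∧
        DecidedBefore (G ++ [(Label.step p o, e)]) l (G.length + 1) (s', p) := by
    intro l v d hl he hon
    obtain ⟨i, -, -, -, hc, -⟩ := E'.trace.completesAt_propose (hlen.trans hl) (d := d) (by
      rw [view_append_length, he, consEvent_cons_self])
    rcases d with _ | u
    · exact absurd hc.completes (consensus_propose_ne_none (hcl' l))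
    · have hd : DecidedBefore (G ++ [(Label.step p o, e)]) l (G.length + 1) u :=
        ⟨i, _, p, _, Nat.lt_succ_self _, hc⟩
      obtain ⟨k, q, hk⟩ := hd.valid hcl'
      obtain rfl := (hon.append (by simp [he])) k q u hk
      exact ⟨rfl, hd⟩
  -- A proposal at `l` would be by `p`, which would then have entered `l` before; entering it again
  -- contradicts the racing.
  have hfresh : ∀ c l, σ.loc p = ⟨c, s, Pc.entering op⟩ →
      e = BaseEvent.rac (Label.step p (some l)) → NoProposal G l := by
    intro c l hl he t q u hv
    obtain rfl := hp l t q u hv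
    obtain ⟨s₁, op', hx, -⟩ := E.trace.propose_invoke hv
    have htl := view_lt_length hv
    obtain ⟨i, j, -, -, a, b, hc, -, hja, hab, hbt, -⟩ := E.trace.compute_visit htl.le hx
    obtain ⟨i', -, -, hc'⟩ := E'.trace.completesAt_enter (hlen.trans hl) (l := l) (by
      rw [view_append_length, he, racEvent_rac])
    obtain ⟨lt, hlt⟩ := hR.exists_isRacingOrder E'.rac
    have hc := hc.append (Label.step q o, e)
    obtain rfl := hlt.new hc hc'
    have := hab.1
    exact hc'.2.2.2 j hc.1 (by omega) l hc.2.2.1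
  generalize hx : σ.loc p = x at hs h
  generalize hy : σ'.loc p = y at hs
  cases h with
  | enter c =>
    cases hs
    exact Or.inl ⟨rfl, SoloPhase.entering c⟩
  | entering c =>
    cases hs with
    | entering => exact Or.inl ⟨rfl, SoloPhase.entering c⟩
    | entered _ _ _ l =>
      exact Or.inl ⟨rfl, SoloPhase.testNew l ((hfresh c l hx rfl).append (by simp))⟩
  | testOld l s₁ hd =>
    cases hs
    exact Or.inl ⟨rfl, SoloPhase.readOld l s₁ G.length (by simp) (hd.append _)
      (by rw [hlen, hx])⟩
  | testNew l hn =>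
    cases hs
    exact Or.inl ⟨rfl, SoloPhase.readNew l (hn.append (by simp))⟩
  | readOld l s₁ t ht hd hxt =>
    cases hs with
    | reading =>
      exact Or.inl ⟨rfl, SoloPhase.readOld l s₁ t (by simp; omega) (hd.append _)
        (by rw [hX t ht, hxt])⟩
    | readNone =>
      exfalso
      obtain ⟨i, hi, hxi, hc, hall⟩ := hread l s₁ none hx rfl
      have h1 := (hd.append _).not_read_none hcl' hc
      have h2 := hall t h1 ht
      rw [hX t ht] at h2
      simp [h2] at hxt
    | readSome _ _ _ d =>
      obtain ⟨i, hi, hxi, hc, hall⟩ := hread l s₁ (some d) hx rfl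
      have hd' : DecidedBefore _ l (G.length + 1) d := ⟨i, _, p, _, Nat.lt_succ_self _, hc⟩
      obtain rfl := hd'.agree hcl' (hd.append _)
      exact Or.inl ⟨rfl, SoloPhase.enter _⟩
  | readNew l hn =>
    cases hs with
    | reading => exact Or.inl ⟨rfl, SoloPhase.readNew l (hn.append (by simp))⟩
    | readNone => exact Or.inl ⟨rfl, SoloPhase.compute l (hn.append (by simp))⟩
    | readSome _ _ _ d =>
      exfalso
      obtain ⟨i, hi, hxi, hc, hall⟩ := hread l s (some d) hx rfl
      have hd' : DecidedBefore _ l (G.length + 1) d := ⟨i, _, p, _, Nat.lt_succ_self _, hc⟩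
      obtain ⟨k, q, hk⟩ := hd'.valid hcl'
      exact (hn.append (by simp)) k q d hk
  | compute l hn =>
    cases hs with
    | ret _ _ _ h => exact absurd (hτ.symm.trans h) hss
    | propose _ _ _ h =>
      subst hτ
      refine Or.inl ⟨rfl, SoloPhase.proposing l _ (hnoW l hn) ?_⟩
      have : OnlyProposal G l ((τ s op).1, p) := fun t q u hv => absurd hv (hn t q u)
      exact this.append (by
        intro q u' h
        simp at h
        exact h.2.symm)
  | proposing l v hlW hon =>
    cases hs with
    | proposing => exact Or.inl ⟨rfl, SoloPhase.proposing l v hlW (hon.append (by simp))⟩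
    | win _ _ _ _ d h => exact Or.inr ⟨l, rfl, rfl, hlW, (hprop l v d hx rfl hon).2⟩
    | lose _ _ _ _ d h =>
      obtain ⟨rfl, -⟩ := hprop l v d hx rfl hon
      simp at h

/-- A reachable state where `p`, the only process so far, has an operation in progress. -/
def SoloState (τ : S → Op → S × Res) (s₀ : S) (p : P) (s s' : S) (op : Op) (W : Finset Lap)
    (σ : UState R C Op Res) : Prop :=
  ∃ G X, Exec τ s₀ G X σ ∧ (runiv τ s₀ R C).Run (G.map Prod.fst) σ ∧
    (∀ l t q u, view (consEvent l) G t = some (Label.inv q (ConsOp.propose u)) → q = p) ∧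
    (∀ l ∈ W, ∃ u, DecidedBefore G l G.length u) ∧ SoloPhase G X p s s' op W (σ.loc p)

/-- A reachable state where `p`, the only process so far, has completed an operation. -/
def SoloIdle (τ : S → Op → S × Res) (s₀ : S) (p : P) (s : S) (W : Finset Lap)
    (σ : UState R C Op Res) : Prop :=
  ∃ G X, Exec τ s₀ G X σ ∧ (runiv τ s₀ R C).Run (G.map Prod.fst) σ ∧
    (∀ l t q u, view (consEvent l) G t = some (Label.inv q (ConsOp.propose u)) → q = p) ∧
    (∀ l ∈ W, ∃ u, DecidedBefore G l G.length u) ∧ (σ.loc p).pc = Pc.idle ∧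
    ((σ.loc p).cur = none ∧ s = s₀ ∨
      ∃ l, (σ.loc p).cur = some l ∧ DecidedBefore G l G.length (s, p))

theorem SoloPhase.pc_ne_idle {x : Loc Lap S Op Res} (h : SoloPhase G X p s s' op W x) :
    x.pc ≠ Pc.idle := by
  cases h <;> simp

theorem SoloIdle.invoke {σ : UState R C Op Res} (h : SoloIdle τ s₀ p s W σ) (s' : S) (op : Op) :
    ∃ σ' : UState R C Op Res, SoloState τ s₀ p s s' op W σ' := by
  obtain ⟨G, X, E, hr, hp, hW, hidle, hc⟩ := h
  have hu := uStep_invoke (τ := τ) (s₀ := s₀) hidle op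
  obtain ⟨X', E'⟩ := E.exists_snoc hu
  refine ⟨_, _, X', E', ?_, fun l t q u hv => ?_, fun l hl => ?_, ?_⟩
  · rw [List.map_append]
    exact hr.snoc ⟨by rw [E.busy p, not_not]; exact hidle, rfl⟩
  · rcases view_append_eq_some hv with hv | ⟨-, hv⟩
    · exact hp l t q u hv
    · simp at hv
  · obtain ⟨u, hu⟩ := hW l hl
    exact ⟨u, (hu.append _).mono (by simp)⟩
  · have hloc : (((runiv τ s₀ R C).invoke p op σ : UState R C Op Res).loc p) =
        ⟨(σ.loc p).cur, (σ.loc p).st,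
          if (σ.loc p).cur.isSome then Pc.test op else Pc.enter op⟩ := by
      simp [runiv, UState.setLoc]
    rw [hloc]
    rcases hc with ⟨hc, rfl⟩ | ⟨l, hc, hd⟩
    · have hst := (E.trace.st_of_cur_none le_rfl (p := p) (by rw [E.loc]; exact hc)).1
      rw [E.loc] at hst
      rw [hc, hst]
      exact SoloPhase.enter none
    · rw [hc]
      exact SoloPhase.testOld l _ ((hd.append _).mono (by simp))

theorem SoloState.step {σ σ' : UState R C Op Res} {o : Option Res}
    (hR : IsRacing R) (hC : ∀ l, (C l).Linearizable (consSpec P (S × P)))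
    (hτ : (τ s op).1 = s') (hss : s' ≠ s) (h : SoloState τ s₀ p s s' op W σ)
    (hσ : (σ', o) ∈ (runiv τ s₀ R C : Impl P Op Res).step p σ) :
    (o = none ∧ SoloState τ s₀ p s s' op W σ') ∨
      ∃ (l : Lap) (hl : l ∉ W), (σ'.loc p).cur = some l ∧
        SoloIdle τ s₀ p s' (Finset.cons l W hl) σ' := by
  obtain ⟨G, X, E, hr, hp, hW, hph⟩ := h
  have hidle := hph.pc_ne_idle
  obtain ⟨e, hu⟩ := exists_uStep hidle (E.wellFormed p) hσ
  let X' : ℕ → P → Loc Lap S Op Res := fun t => if t ≤ G.length then X t else σ'.loc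
  have hX : ∀ t ≤ G.length, X' t = X t := fun t ht => if_pos ht
  have E' := E.snoc hu hX (if_neg (by omega))
  have hr' : (runiv τ s₀ R C).Run ((G ++ [(Label.step p o, e)]).map Prod.fst) σ' := by
    rw [List.map_append]
    exact hr.snoc ⟨(E.busy p).2 hidle, hσ⟩
  have hp' : ∀ l t q u, view (consEvent l) (G ++ [(Label.step p o, e)]) t =
      some (Label.inv q (ConsOp.propose u)) → q = p := by
    intro l t q u hv
    rcases view_append_eq_some hv with hv | ⟨-, hv⟩
    · exact hp l t q u hv
    · obtain rfl : e = _ := consEvent_eq_some.1 hv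
      exact hu.localStep.cons_proc
  have hW' : ∀ l ∈ W, ∃ u, DecidedBefore (G ++ [(Label.step p o, e)]) l
      (G ++ [(Label.step p o, e)]).length u := by
    intro l hl
    obtain ⟨u, hu⟩ := hW l hl
    exact ⟨u, (hu.append _).mono (by simp)⟩
  rcases hph.step hR hC E E' hX hu.localStep hp hW hτ hss with ⟨ho, h⟩ | ⟨l, hcur, hidle', hl, hd⟩
  · exact Or.inl ⟨ho, _, X', E', hr', hp', hW', h⟩
  · refine Or.inr ⟨l, hl, hcur, _, X', E', hr', hp', fun l' hl' => ?_, hidle',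
      Or.inr ⟨l, hcur, hd.mono (by simp)⟩⟩
    rcases Finset.mem_cons.1 hl' with rfl | hl'
    · exact ⟨_, hd.mono (by simp)⟩
    · exact hW' l' hl'

/-- If the operation never ended, some silent step would lead from each solo state to another one.
Iterating a choice of such steps gives an endless run of `p` alone, against obstruction-freedom. -/
theorem SoloState.exists_idle (hR : IsRacing R)
    (hC : ∀ l, (C l).Linearizable (consSpec P (S × P)))
    (hof : (runiv τ s₀ R C : Impl P Op Res).ObstructionFree)
    (hτ : (τ s op).1 = s') (hss : s' ≠ s) {σ : UState R C Op Res}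
    (h : SoloState τ s₀ p s s' op W σ) :
    ∃ (σ' : UState R C Op Res) (l : Lap) (hl : l ∉ W), (σ'.loc p).cur = some l ∧
      SoloIdle τ s₀ p s' (Finset.cons l W hl) σ' := by
  by_contra hn
  have hnext : ∀ x : {σ : UState R C Op Res // SoloState τ s₀ p s s' op W σ},
      ∃ y : {σ : UState R C Op Res // SoloState τ s₀ p s s' op W σ},
        (y.1, none) ∈ (runiv τ s₀ R C : Impl P Op Res).step p x.1 := by
    rintro ⟨x, hx⟩
    obtain ⟨⟨y, o⟩, hy⟩ := (runiv τ s₀ R C : Impl P Op Res).step_nonempty p x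
    rcases hx.step hR hC hτ hss hy with ⟨rfl, hy'⟩ | ⟨l, hl, hcur, hi⟩
    · exact ⟨⟨y, hy'⟩, hy⟩
    · exact absurd ⟨y, l, hl, hcur, hi⟩ hn
  choose f hf using hnext
  obtain ⟨G, X, E, hr, -, -, hph⟩ := id h
  refine hof _ σ p hr ((E.busy p).2 hph.pc_ne_idle) ⟨fun n => (f^[n] ⟨σ, h⟩).1, rfl, fun n => ?_⟩
  have := hf (f^[n] ⟨σ, h⟩)
  rwa [← Function.iterate_succ_apply' f n] at this

/-- If all laps entered were in `F`, then after `k` operations the set `W` of laps won would have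
`k` elements and lie in `F`, which is impossible for `k = F.card + 1`. -/
theorem runiv_unbounded (hR : IsRacing R) (hC : ∀ l, (C l).Linearizable (consSpec P (S × P)))
    (hof : (runiv τ s₀ R C : Impl P Op Res).ObstructionFree) (p : P) (s : ℕ → S) (ops : ℕ → Op)
    (h0 : s 0 = s₀) (hs : ∀ n, s (n + 1) = (τ (s n) (ops n)).1 ∧ s (n + 1) ≠ s n)
    (F : Finset Lap) :
    ∃ (h : List (Label P Op Res)) (σ : UState R C Op Res) (p : P) (l : Lap),
      (runiv τ s₀ R C).Run h σ ∧ (σ.loc p).cur = some l ∧ l ∉ F := by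
  by_contra hn
  have key : ∀ k, ∃ (W : Finset Lap) (σ : UState R C Op Res), W.card = k ∧ W ⊆ F ∧
      SoloIdle τ s₀ p (s k) W σ := by
    intro k
    induction k with
    | zero =>
      exact ⟨∅, (runiv τ s₀ R C : Impl P Op Res).init, rfl, by simp, [], _, Exec.nil,
        Impl.Run.nil, by simp [view], by simp, rfl, Or.inl ⟨rfl, h0⟩⟩
    | succ k ih =>
      obtain ⟨W, σ, hcard, hsub, hi⟩ := ih
      obtain ⟨σ₁, h₁⟩ := hi.invoke (s (k + 1)) (ops k)
      obtain ⟨σ₂, l, hl, hcur, h₂⟩ := h₁.exists_idle hR hC hof (hs k).1.symm (hs k).2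
      refine ⟨Finset.cons l W hl, σ₂, by simp [hcard], ?_, h₂⟩
      intro l' hl'
      rcases Finset.mem_cons.1 hl' with rfl | hl'
      · by_contra hF
        obtain ⟨G, X, -, hr, -⟩ := h₂
        exact hn ⟨_, σ₂, p, l', hr, hcur, hF⟩
      · exact hsub hl'
  obtain ⟨W, -, hcard, hsub, -⟩ := key (F.card + 1)
  have := Finset.card_le_card hsub
  omega

end Unbounded

theorem mainTheorem2 {P Lap S Op Res : Type*} (τ : S → Op → S × Res) (s₀ : S)
    (R : Impl P Unit Lap) (C : Lap → Impl P (ConsOp (S × P)) (Option (S × P)))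
    (hR : IsRacing R) (hRwf : R.WaitFree)
    (hClin : ∀ l, (C l).Linearizable (consSpec P (S × P)))
    (hCof : ∀ l, (C l).ObstructionFree) :
    (runiv τ s₀ R C).ObstructionFree ∧
    (runiv τ s₀ R C).Linearizable (seqSpec P τ s₀) ∧
    -- the number of consensus objects in use is not bounded as soon as there is a process and the
    -- object admits an infinite sequence of operations that all change its state
    (Nonempty P → ∀ (s : ℕ → S) (ops : ℕ → Op), s 0 = s₀ →
      (∀ n, s (n + 1) = (τ (s n) (ops n)).1 ∧ s (n + 1) ≠ s n) →
      ∀ F : Finset Lap, ∃ (h : List (Label P Op Res)) (σ : UState R C Op Res) (p : P) (l : Lap),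
        (runiv τ s₀ R C).Run h σ ∧ (σ.loc p).cur = some l ∧ l ∉ F) := by
  have hof := runiv_obstructionFree (τ := τ) (s₀ := s₀) hR hRwf hClin hCof
  exact ⟨hof, runiv_linearizable hR hClin,
    fun ⟨p⟩ s ops h0 hs F => runiv_unbounded hR hClin hof p s ops h0 hs F⟩
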